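/- Let $(X,d,\varphi)$ be an irreducible Smale space: $X$ is a compact metric space, $\varphi:X\to X$ is a homeomorphism, and there are constants $\varepsilon_X>0$, $\lambda>1$ and a bracket $[x,y]\in X$, defined and continuous for $d(x,y)<\varepsilon_X$, such that $[x,x]=x$, $[x,[y,z]]=[x,z]$, $[[x,y],z]=[x,z]$ and $\varphi[x,y]=[\varphi(x),\varphi(y)]$ whenever both sides are defined, $d(\varphi(x),\varphi(y))\le\lambda^{-1}d(x,y)$ whenever $[x,y]=y$, and $d(\varphi^{-1}(x),\varphi^{-1}(y))\le\lambda^{-1}d(x,y)$ whenever $[x,y]=x$; irreducible means that the periodic points of $\varphi$ are dense and that some orbit $\{\varphi^n(x):n\in\mathbb Z\}$ is dense. For $0\le\delta\le\varepsilon_X$ put $X^s(x,\delta)=\{y: d(x,y)<\delta,\ [y,x]=x\}$ and $X^u(x,\delta)=\{y: d(x,y)<\delta,\ [x,y]=x\}$. Write $x\sim_s y$ if $d(\varphi^n(x),\varphi^n(y))\to0$ and $x\sim_u y$ if $d(\varphi^{-n}(x),\varphi^{-n}(y))\to0$ as $n\to+\infty$, and let $X^s(x)$, $X^u(x)$ be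 the classes of $x$, with the topologies that have the sets $X^s(y,\delta)$, respectively $X^u(y,\delta)$, $\delta>0$, as neighbourhood bases. Let $P,Q\subset X$ be finite, non-empty, disjoint, $\varphi$-invariant sets of periodic points, and put $X^s(P)=\bigcup_{p\in P}X^s(p)$, $X^u(Q)=\bigcup_{q\in Q}X^u(q)$, $X^h(P,Q)=X^s(P)\cap X^u(Q)$ and $\mathcal H=\ell^2(X^h(P,Q))$. Let $G=\{(v,w): v\sim_s w,\ v,w\in X^u(Q)\}$ with its étale topology, generated by the sets of pairs $(h^s(x),x)\in G$ with $x\in X^u(w,\delta)$, $h^s(x)\in X^u(v,\delta)$ and $\varphi^N(h^s(x))\in X^s(\varphi^N(x),\varepsilon_X)$. Here $(v,w)\in G$, $h^s(x)=\varphi^{-N}[\varphi^N(x),\varphi^N(v)]$, $N\ge0$ is such that $\varphi^N(w)\in X^s(\varphi^N(v),\varepsilon_X/2)$, and $0<\delta<\varepsilon_X/2$ is such that $\varphi^n(X^u(y,\delta))\subset X^u(\varphi^n(y),\varepsilon_X/2)$ for $y\in\{v,w\}$ and $0\le n\le N$. For $f\in C_c(G)$ let $$(\pi(f)\xi)(x)=\sum_{y:\,(x,y)\in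 G}f(x,y)\,\xi(y)\qquad(\xi\in\mathcal H,\ x\in X^h(P,Q)),$$ and let $S=S(X,\varphi,Q)$ be the $C^*$-algebra of operators on $\mathcal H$ generated by the operators $\pi(f)$, $f\in C_c(G)$. A function $a\in C_c(X^u(Q))$ acts on $\mathcal H$ as a function on the units $(x,x)$ of $G$, that is, by multiplication. Let $0<\varepsilon\le\lambda^{-1}\varepsilon_X/2$, put $X^s(P,\varepsilon)=\bigcup_{p\in P}X^s(p,\varepsilon)$, and let $\omega_0:X^s(P)\to[0,1]$ be any continuous function that is $0$ on the closure of $X^s(P,\varepsilon)$ in $X^s(P)$ and $1$ on $X^s(P)\setminus\varphi^{-1}(X^s(P,\varepsilon))$. For $x\in X^s(P)\setminus P$ put $$\omega_s(x)=\sum_{n=0}^\infty\omega_0(\varphi^n(x))-\sum_{n=1}^\infty\bigl(1-\omega_0(\varphi^{-n}(x))\bigr),$$ and let $D$ be the operator $D\delta_x=\omega_s(x)\delta_x$ on $\mathcal H$ with domain $\{\xi:\sum_x\omega_s(x)^2|\xi(x)|^2<\infty\}$. Then $(S,\mathcal H,D)$ is a non-unital, $\theta$-summable spectral triple. That is: 1.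 For every $f\in C_c(G)$ the operator $\pi(f)$ is well defined and bounded on $\mathcal H$, it maps the domain of $D$ into itself, and the commutator $[D,\pi(f)]$ extends to a bounded operator. 2. $\mathcal H$ is separable, $D$ is self-adjoint and unbounded, the set of those $a\in S$ for which $a$ preserves the domain of $D$ and $[D,a]$ is bounded is norm dense in $S$, and $a(1+D^2)^{-1}$ is compact for every $a\in S$. 3. The algebra $S$ has no unit. 4. For every $a\in C_c(X^u(Q))$ and every $t>0$ the operator $a\,e^{-t(1+D^2)}$ is trace class; in particular $\operatorname{Tr}(a\,e^{-t(1+D^2)})<\infty$. -/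

import Mathlib

open Set Filter Topology
open scoped ENNReal CompactlySupported

noncomputable section

universe u

/-! ## Smale spaces -/

/-- A Smale space structure on a compact metric space `X`: a homeomorphism `φ`, constants
`eps = ε_X > 0` and `lam = λ > 1`, and a bracket map, continuous on `{(x, y) | d(x, y) < ε_X}`
and subject to the Ruelle-Putnam axioms. The bracket is written as a total function; its values
at pairs with `d(x, y) ≥ ε_X` are never constrained. -/
structure SmaleSpace (X : Type u) [MetricSpace X] [CompactSpace X] where
  φ : X ≃ₜ X
  eps : ℝ
  lam : ℝ
  bracket : X → X → X
  eps_pos : 0 < eps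
  one_lt_lam : 1 < lam
  continuousOn_bracket :
    ContinuousOn (fun q : X × X => bracket q.1 q.2) {q | dist q.1 q.2 < eps}
  bracket_self : ∀ x, bracket x x = x
  bracket_right : ∀ x y z, dist y z < eps → dist x (bracket y z) < eps → dist x z < eps →
    bracket x (bracket y z) = bracket x z
  bracket_left : ∀ x y z, dist x y < eps → dist (bracket x y) z < eps → dist x z < eps →
    bracket (bracket x y) z = bracket x z
  bracket_map : ∀ x y, dist x y < eps → dist (φ x) (φ y) < eps →
    bracket (φ x) (φ y) = φ (bracket x y)
  contract_stable : ∀ x y, dist x y < eps → bracket x y = y →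
    dist (φ x) (φ y) ≤ lam⁻¹ * dist x y
  contract_unstable : ∀ x y, dist x y < eps → bracket x y = x →
    dist (φ.symm x) (φ.symm y) ≤ lam⁻¹ * dist x y

namespace SmaleSpace

section Dynamics

variable {X : Type u} [MetricSpace X] [CompactSpace X] (S : SmaleSpace X)

/-- Irreducibility: periodic points are dense and some full orbit `{φ^n(x) | n ∈ ℤ}` is dense. -/
def Irreducible : Prop :=
  Dense (Function.periodicPts S.φ) ∧ ∃ x : X, Dense (range fun n : ℤ => (S.φ ^ n) x)

/-- The local stable set `X^s(x, δ)`, for `0 ≤ δ ≤ ε_X`. -/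
def localStable (x : X) (δ : ℝ) : Set X := {y | dist x y < δ ∧ S.bracket y x = x}

/-- The local unstable set `X^u(x, δ)`, for `0 ≤ δ ≤ ε_X`. -/
def localUnstable (x : X) (δ : ℝ) : Set X := {y | dist x y < δ ∧ S.bracket x y = x}

/-- Stable equivalence `x ∼ₛ y`. -/
def StableEquiv (x y : X) : Prop :=
  Tendsto (fun n : ℕ => dist (S.φ^[n] x) (S.φ^[n] y)) atTop (𝓝 0)

/-- Unstable equivalence `x ∼ᵤ y`. -/
def UnstableEquiv (x y : X) : Prop :=
  Tendsto (fun n : ℕ => dist (S.φ.symm^[n] x) (S.φ.symm^[n] y)) atTop (𝓝 0)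

/-- `X^s(P)`, the union of the stable classes of the points of `P`. -/
def stableSet (P : Set X) : Set X := {x | ∃ p ∈ P, S.StableEquiv p x}

/-- `X^u(Q)`, the union of the unstable classes of the points of `Q`. -/
def unstableSet (Q : Set X) : Set X := {x | ∃ q ∈ Q, S.UnstableEquiv q x}

/-- `X^h(P, Q) = X^s(P) ∩ X^u(Q)`. -/
def heteroclinic (P Q : Set X) : Set X := S.stableSet P ∩ S.unstableSet Q

/-- `X^s(P, δ)`, the union of the local stable sets of the points of `P`. -/
def localStableSet (P : Set X) (δ : ℝ) : Set X := ⋃ p ∈ P, S.localStable p δ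

/-- The topology on `X` in which the local stable sets `X^s(y, δ)`, `0 < δ ≤ ε_X`, form a base.
Every global stable class is open in it and carries its leaf topology as subspace topology. -/
abbrev stableTopology : TopologicalSpace X :=
  TopologicalSpace.generateFrom {U | ∃ y δ, 0 < δ ∧ δ ≤ S.eps ∧ U = S.localStable y δ}

/-- The topology on `X` in which the local unstable sets `X^u(y, δ)`, `0 < δ ≤ ε_X`, form a base.
Every global unstable class is open in it and carries its leaf topology as subspace topology. -/
abbrev unstableTopology : TopologicalSpace X :=
  TopologicalSpace.generateFrom {U | ∃ y δ, 0 < δ ∧ δ ≤ S.eps ∧ U = S.localUnstable y δ}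

/-! ## The étale groupoid `G^s(X, φ, Q)` -/

/-- The unit space `X^u(Q)` as a type; it carries its leaf topology, not the topology of `X`. -/
def UnitSpace (Q : Set X) : Type u := {x : X // x ∈ S.unstableSet Q}

instance (Q : Set X) : TopologicalSpace (S.UnitSpace Q) :=
  TopologicalSpace.induced Subtype.val S.unstableTopology

/-- The groupoid `G^s(X, φ, Q) = {(v, w) | v ∼ₛ w and v, w ∈ X^u(Q)}`. -/
def StableGroupoid (Q : Set X) : Type u :=
  {g : X × X // S.StableEquiv g.1 g.2 ∧ g.1 ∈ S.unstableSet Q ∧ g.2 ∈ S.unstableSet Q}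

/-- The map `h^s(x) = φ^{-N}[φ^N(x), φ^N(v)]`. -/
def holonomy (v : X) (N : ℕ) (x : X) : X :=
  S.φ.symm^[N] (S.bracket (S.φ^[N] x) (S.φ^[N] v))

/-- The conditions on `N` and `δ` under which `h^s` is a local homeomorphism from `X^u(w, δ)`
to the local unstable set of `v`. -/
def IsAdmissible (Q : Set X) (v w : X) (N : ℕ) (δ : ℝ) : Prop :=
  S.StableEquiv v w ∧ v ∈ S.unstableSet Q ∧ w ∈ S.unstableSet Q ∧
  S.φ^[N] w ∈ S.localStable (S.φ^[N] v) (S.eps / 2) ∧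
  0 < δ ∧ δ < S.eps / 2 ∧
  (∀ n ≤ N, MapsTo S.φ^[n] (S.localUnstable v δ) (S.localUnstable (S.φ^[n] v) (S.eps / 2))) ∧
  (∀ n ≤ N, MapsTo S.φ^[n] (S.localUnstable w δ) (S.localUnstable (S.φ^[n] w) (S.eps / 2)))

/-- The basic set `V^s(v, w, h^s, δ)` of all `(h^s(x), x)` with `x ∈ X^u(w, δ)` and
`h^s(x) ∈ X^u(v, δ)`. The last clause says that `φ^N(h^s(x)) = [φ^N(x), φ^N(v)]` lies on the local
stable set of `φ^N(x)`, as in `{[x, y]} = X^s(x, ε_X) ∩ X^u(y, ε_X)`; it rules out brackets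
of points at distance nearly `ε_X` that the axioms leave uncontrolled. -/
def basicSet (Q : Set X) (v w : X) (N : ℕ) (δ : ℝ) : Set (S.StableGroupoid Q) :=
  {g | g.1.2 ∈ S.localUnstable w δ ∧ g.1.1 = S.holonomy v N g.1.2 ∧
    g.1.1 ∈ S.localUnstable v δ ∧ S.φ^[N] g.1.1 ∈ S.localStable (S.φ^[N] g.1.2) S.eps}

/-- The étale topology of the groupoid, generated by the basic sets. -/
instance (Q : Set X) : TopologicalSpace (S.StableGroupoid Q) :=
  TopologicalSpace.generateFrom
    {U | ∃ v w N δ, S.IsAdmissible Q v w N δ ∧ U = S.basicSet Q v w N δ}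

/-! ## The fundamental representation and the stable algebra -/

/-- The Hilbert space `ℓ²(X^h(P, Q))`. -/
abbrev HilbertSp (P Q : Set X) : Type u := lp (fun _ : S.heteroclinic P Q => ℂ) 2

/-- `T = π(f)`, that is `(T ξ)(x) = ∑ f(x, y) ξ(y)` over the `y` with `(x, y) ∈ G^s(X, φ, Q)`;
such `y` lie in `X^h(P, Q)` because `x` does. For compactly supported `f` the sum is finite. -/
def Represents (P Q : Set X) (f : S.StableGroupoid Q → ℂ)
    (T : S.HilbertSp P Q →L[ℂ] S.HilbertSp P Q) : Prop :=
  ∀ (ξ : S.HilbertSp P Q) (x : S.heteroclinic P Q),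
    T ξ x = ∑' y : {y : S.heteroclinic P Q // S.StableEquiv x.1 y.1},
      f ⟨(x.1, y.1.1), y.2, x.2.2, y.1.2.2⟩ * ξ y.1

/-- The operators `π(f)`, `f ∈ C_c(G^s(X, φ, Q))`. -/
def compactOps (P Q : Set X) : Set (S.HilbertSp P Q →L[ℂ] S.HilbertSp P Q) :=
  {T | ∃ f : C_c(S.StableGroupoid Q, ℂ), S.Represents P Q f T}

/-- The stable algebra `S(X, φ, Q)`, represented on `ℓ²(X^h(P, Q))`: the norm-closed `*`-algebra
generated by the operators `π(f)` with `f ∈ C_c(G^s(X, φ, Q))`. -/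
def stableAlgebra (P Q : Set X) :
    NonUnitalStarSubalgebra ℂ (S.HilbertSp P Q →L[ℂ] S.HilbertSp P Q) :=
  (NonUnitalStarAlgebra.adjoin ℂ (S.compactOps P Q)).topologicalClosure

open Classical in
/-- A function on the unit space `X^u(Q)`, as a function on the groupoid supported on units. -/
def unitFunction (Q : Set X) (a : S.UnitSpace Q → ℂ) : S.StableGroupoid Q → ℂ :=
  fun g => if g.1.1 = g.1.2 then a ⟨g.1.1, g.2.2.1⟩ else 0

/-! ## The function `ω_s` -/

/-- The admissible functions `ω₀ : X^s(P) → [0, 1]`: continuous for the leaf topology, `0` on the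
closure of `X^s(P, ε)` in `X^s(P)`, and `1` on `X^s(P) \ φ⁻¹(X^s(P, ε))`. Only the
values of `ω₀` on `X^s(P)` matter. -/
structure IsCutoff (P : Set X) (ε : ℝ) (ω₀ : X → ℝ) : Prop where
  mem_Icc : ∀ x ∈ S.stableSet P, ω₀ x ∈ Icc (0 : ℝ) 1
  continuousOn : @ContinuousOn X ℝ S.stableTopology _ ω₀ (S.stableSet P)
  eq_zero : ∀ x ∈ S.stableSet P, x ∈ closure[S.stableTopology] (S.localStableSet P ε) → ω₀ x = 0
  eq_one : ∀ x ∈ S.stableSet P, S.φ x ∉ S.localStableSet P ε → ω₀ x = 1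

/-- `ω_s = ∑_{n ≥ 0} ω₀ ∘ φ^n - ∑_{n ≥ 1} (1 - ω₀) ∘ φ^{-n}`; on `X^s(P) \ P` both sums have only
finitely many nonzero terms. -/
def omegaS (ω₀ : X → ℝ) (x : X) : ℝ :=
  (∑' n : ℕ, ω₀ (S.φ^[n] x)) - ∑' n : ℕ, (1 - ω₀ (S.φ.symm^[n + 1] x))

end Dynamics

end SmaleSpace

/-! ## Unbounded operators, spectral triples and trace class operators -/

/-- The diagonal operator `D δ_i = ω(i) δ_i` on `ℓ²(ι)`, with its maximal domain
`{ξ | ∑ ω(i)² |ξ(i)|² < ∞}`. -/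
def diagonalOp {ι : Type u} (ω : ι → ℝ) :
    lp (fun _ : ι => ℂ) 2 →ₗ.[ℂ] lp (fun _ : ι => ℂ) 2 where
  domain :=
    { carrier := {ξ | Memℓp (fun i => (ω i : ℂ) * ξ i) 2}
      zero_mem' := by
        have e : (fun i => (ω i : ℂ) * (0 : lp (fun _ : ι => ℂ) 2) i) = (0 : ι → ℂ) := by
          funext i
          simp
        change Memℓp _ 2
        rw [e]
        exact (zero_memℓp : Memℓp (0 : ι → ℂ) 2)
      add_mem' := by
        intro ξ η hξ hη
        have e : (fun i => (ω i : ℂ) * (ξ + η) i)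
            = (fun i => (ω i : ℂ) * ξ i) + fun i => (ω i : ℂ) * η i := by
          funext i
          simp [mul_add]
        change Memℓp _ 2
        rw [e]
        exact Memℓp.add hξ hη
      smul_mem' := by
        intro c ξ hξ
        have e : (fun i => (ω i : ℂ) * (c • ξ) i) = c • fun i => (ω i : ℂ) * ξ i := by
          funext i
          simp only [lp.coeFn_smul, Pi.smul_apply, smul_eq_mul]
          ring
        change Memℓp _ 2
        rw [e]
        exact Memℓp.const_smul hξ c }
  toFun :=
    { toFun := fun ξ => ⟨fun i => (ω i : ℂ) * ξ.1 i, ξ.2⟩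
      map_add' := by
        intro ξ η
        ext i
        exact mul_add _ _ _
      map_smul' := by
        intro c ξ
        ext i
        exact mul_left_comm _ _ _ }

section Operators

variable {H : Type u} [NormedAddCommGroup H] [InnerProductSpace ℂ H] [CompleteSpace H]

/-- `[D, a]` is bounded: `a` preserves the domain of `D`, and `D a - a D` is on that domain
the restriction of a bounded operator. -/
def HasBoundedCommutator (D : H →ₗ.[ℂ] H) (a : H →L[ℂ] H) : Prop :=
  ∃ T : H →L[ℂ] H, ∀ ξ : D.domain, ∃ h : a ξ ∈ D.domain, D ⟨a ξ, h⟩ - a (D ξ) = T ξ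

/-- `R = (1 + D²)⁻¹`: the range of `R` lies in the domain of `D²`, and `(1 + D²) R = 1`. For
self-adjoint `D` there is exactly one such `R`, since then `1 + D²` is injective. -/
def IsInvOneAddSq (D : H →ₗ.[ℂ] H) (R : H →L[ℂ] H) : Prop :=
  ∀ ξ : H, ∃ h₁ : R ξ ∈ D.domain, ∃ h₂ : D ⟨R ξ, h₁⟩ ∈ D.domain,
    R ξ + D ⟨D ⟨R ξ, h₁⟩, h₂⟩ = ξ

/-- `e^{-t(1 + D²)}` for `t > 0`, in terms of `R = (1 + D²)⁻¹`: functional calculus of `R` with the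
function `r ↦ e^{-t / r}`, extended by its limit `0` to `r = 0`. -/
def heatOp (R : H →L[ℂ] H) (t : ℝ) : H →L[ℂ] H :=
  cfc (fun r : ℝ => if r = 0 then 0 else Real.exp (-t / r)) R

/-- `T` is trace class: `Tr |T| = ∑ ⟨b_i, |T| b_i⟩` is finite, where `|T| = (T* T)^{1/2}` and `b`
is an orthonormal basis (the sum does not depend on its choice). -/
def IsTraceClass (T : H →L[ℂ] H) : Prop :=
  ∃ (ι : Type u) (b : HilbertBasis ι ℂ H),
    Summable fun i => (inner ℂ (b i) (CFC.abs T (b i))).re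

/-- `(A, H, D)` is a spectral triple, for a `*`-algebra `A` of bounded operators on `H`. -/
structure IsSpectralTriple (A : NonUnitalStarSubalgebra ℂ (H →L[ℂ] H)) (D : H →ₗ.[ℂ] H) :
    Prop where
  separable : TopologicalSpace.SeparableSpace H
  selfAdjoint : IsSelfAdjoint D
  unbounded : ¬ ∃ C : ℝ, ∀ ξ : D.domain, ‖D ξ‖ ≤ C * ‖ξ‖
  dense_commutator :
    (A : Set (H →L[ℂ] H)) ⊆ closure {a | a ∈ A ∧ HasBoundedCommutator D a}
  compact_resolvent :
    ∃ R : H →L[ℂ] H, IsInvOneAddSq D R ∧ ∀ a ∈ A, IsCompactOperator (a * R)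

/-- The algebra `A` has no unit. -/
def IsNonunital (A : NonUnitalStarSubalgebra ℂ (H →L[ℂ] H)) : Prop :=
  ¬ ∃ e ∈ A, ∀ a ∈ A, e * a = a ∧ a * e = a

end Operators

/-- `θ`-summability over the stable algebra: `a e^{-t(1 + D²)}` is trace class for all `t > 0`
and all `a ∈ C_c(X^u(Q))`, acting on `ℓ²(X^h(P, Q))` as functions on the units of the groupoid. -/
def SmaleSpace.IsThetaSummable {X : Type u} [MetricSpace X] [CompactSpace X] (S : SmaleSpace X)
    (P Q : Set X) (D : S.HilbertSp P Q →ₗ.[ℂ] S.HilbertSp P Q) : Prop :=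
  ∃ R : S.HilbertSp P Q →L[ℂ] S.HilbertSp P Q, IsInvOneAddSq D R ∧
    ∀ a : C_c(S.UnitSpace Q, ℂ), ∃ T : S.HilbertSp P Q →L[ℂ] S.HilbertSp P Q,
      S.Represents P Q (S.unitFunction Q a) T ∧ ∀ t : ℝ, 0 < t → IsTraceClass (T * heatOp R t)

/-- The Dirac operator `D δ_x = ω_s(x) δ_x` on `ℓ²(X^h(P, Q))`. -/
def SmaleSpace.dirac {X : Type u} [MetricSpace X] [CompactSpace X] (S : SmaleSpace X)
    (P Q : Set X) (ω₀ : X → ℝ) : S.HilbertSp P Q →ₗ.[ℂ] S.HilbertSp P Q :=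
  diagonalOp fun x : S.heteroclinic P Q => S.omegaS ω₀ x.1

end

/-!
Heteroclinic points are graded by an integer: the entry time `τ(x)` of `x ∈ X^h(P, Q)` is the
least `n` with `φⁿ(x) ∈ X^s(P, ε)`. It exists because `X^s(P, ε)` is forward invariant, absorbs
each forward orbit in `X^s(P)`, and cannot contain a full backward orbit of a point outside `P`.
All but one of the terms of `ω_s(x)` are `0` or `1`, according to the side of `τ(x)` on which they
lie, so `τ(x) - 1 ≤ ω_s(x) ≤ τ(x)` (`IsPeriodicPair.omegaS_mem_Icc`), and `ω_s` can be replaced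
by `τ` in all estimates.

Compact parts of `X^u(Q)` are covered by finitely many local unstable sets (`leafCover`). A point
`x` of a local unstable set with `φⁿ(x)` in a given local stable set is determined by its
itinerary of length `n + 1` through a finite cover of `X` by small sets
(`exists_card_le_pow`). Hence a `leafCover` contains at most `C Mⁿ⁺¹` heteroclinic points with
`τ ≤ n`. This count has four consequences: `X^h(P, Q)` is countable, `τ` is bounded below on a
`leafCover`, `(1 + ω_s²)⁻¹` tends to `0` on it, and `e^{-t(1 + ω_s²)}` is summable over it since
the Gaussian decay beats the exponential growth.

The support of `f ∈ C_c(G)` is covered by finitely many basic sets, which are graphs of injective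
partial maps, so the kernel of `π(f)` has boundedly many entries in each row and column and
`π(f)` is bounded (`exists_clm_of_kernel`). On a basic set `φ^N(x)` and `φ^N(y)` lie on one local
stable leaf for a fixed `N`; together with the lower bound for `τ` this bounds `|τ(x) - τ(y)|`
(`IsPeriodicPair.exists_abs_entryTime_sub_le`), so that the kernel
`(ω_s(x) - ω_s(y)) f(x, y)` of `[D, π(f)]` is of the same type. These properties pass to the
generated `*`-algebra (`isLocalOperator_of_mem_adjoin`), and compactness of `a (1 + D²)⁻¹` passes
to its norm closure.

Irreducibility provides a heteroclinic point (`IsPeriodicPair.heteroclinic_nonempty`). Along its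
orbit `τ` takes all integer values, so `D` is unbounded, and its forward orbit leaves every
`leafCover`. A unit of the algebra would be the identity, because bump functions on the unit space
give operators that fix a given `δ_x`; but the identity has distance at least `1` from each
operator that vanishes on some `δ_x`.
-/

namespace SmaleSpace

section Dynamics

variable {X : Type*} [MetricSpace X] [CompactSpace X] (S : SmaleSpace X)

/-! ### Local stable and unstable sets -/

/-- The inverse Smale space `(X, φ⁻¹)`, with bracket `(x, y) ↦ [y, x]`. Its stable sets are the
unstable sets of the given space, so that each statement about stable sets has an unstable
counterpart. -/
def inv : SmaleSpace X where
  φ := S.φ.symm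
  eps := S.eps
  lam := S.lam
  bracket x y := S.bracket y x
  eps_pos := S.eps_pos
  one_lt_lam := S.one_lt_lam
  continuousOn_bracket := by
    have h := S.continuousOn_bracket.comp
      (continuous_swap.continuousOn (s := {q | dist q.1 q.2 < S.eps})) (fun q hq => by
        change dist q.2 q.1 < S.eps
        rw [dist_comm]
        exact hq)
    exact h
  bracket_self := S.bracket_self
  bracket_right x y z h₁ h₂ h₃ := by
    rw [dist_comm] at h₁ h₂ h₃
    exact S.bracket_left z y x h₁ h₂ h₃
  bracket_left x y z h₁ h₂ h₃ := by
    rw [dist_comm] at h₁ h₂ h₃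
    exact S.bracket_right z y x h₁ h₂ h₃
  bracket_map x y h₁ h₂ := by
    rw [dist_comm] at h₁ h₂
    have e := S.bracket_map (S.φ.symm y) (S.φ.symm x) h₂ (by simpa using h₁)
    simp only [Homeomorph.apply_symm_apply] at e
    rw [e, Homeomorph.symm_apply_apply]
  contract_stable x y h₁ h₂ := by
    rw [dist_comm] at h₁
    rw [dist_comm, dist_comm x y]
    exact S.contract_unstable y x h₁ h₂
  contract_unstable x y h₁ h₂ := by
    rw [dist_comm] at h₁
    rw [dist_comm, dist_comm x y]
    exact S.contract_stable y x h₁ h₂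

lemma lam_pos : 0 < S.lam := zero_lt_one.trans S.one_lt_lam

lemma inv_lam_lt_one : S.lam⁻¹ < 1 := inv_lt_one_of_one_lt₀ S.one_lt_lam

lemma inv_lam_nonneg : 0 ≤ S.lam⁻¹ := inv_nonneg.2 S.lam_pos.le

variable {S}

lemma self_mem_localStable {x : X} {δ : ℝ} (hδ : 0 < δ) : x ∈ S.localStable x δ :=
  ⟨by simpa using hδ, S.bracket_self x⟩

lemma localStable_mono {x : X} {δ δ' : ℝ} (h : δ ≤ δ') : S.localStable x δ ⊆ S.localStable x δ' :=
  fun _ hy => ⟨hy.1.trans_le h, hy.2⟩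

lemma mem_localStable_comm {x y : X} {δ : ℝ} (hδ : δ ≤ S.eps) :
    y ∈ S.localStable x δ ↔ x ∈ S.localStable y δ := by
  have key : ∀ x y : X, y ∈ S.localStable x δ → x ∈ S.localStable y δ := by
    rintro x y ⟨h₁, h₂⟩
    have h₁' := h₁.trans_le hδ
    refine ⟨by rwa [dist_comm], ?_⟩
    have := S.bracket_left y x y (by rwa [dist_comm]) (by rwa [h₂]) (by simpa using S.eps_pos)
    rwa [h₂, S.bracket_self] at this
  exact ⟨key x y, key y x⟩

lemma localStable_trans {x y z : X} {δ : ℝ} (hy : y ∈ S.localStable x S.eps)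
    (hz : z ∈ S.localStable y S.eps) (hδ : δ ≤ S.eps) (h : dist x z < δ) :
    z ∈ S.localStable x δ := by
  refine ⟨h, ?_⟩
  have := S.bracket_left z y x (by rw [dist_comm]; exact hz.1)
    (by rw [hz.2, dist_comm]; exact hy.1) (by rw [dist_comm]; exact h.trans_le hδ)
  rw [hz.2, hy.2] at this
  exact this.symm

lemma map_mem_localStable {x y : X} {δ : ℝ} (hδ : δ ≤ S.eps) (hy : y ∈ S.localStable x δ) :
    S.φ y ∈ S.localStable (S.φ x) (S.lam⁻¹ * δ) := by
  have h₁ := hy.1.trans_le hδ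
  have h₂ : dist (S.φ x) (S.φ y) ≤ S.lam⁻¹ * dist x y := by
    rw [dist_comm, dist_comm x y]
    exact S.contract_stable y x (by rwa [dist_comm]) hy.2
  have h₃ : dist (S.φ x) (S.φ y) ≤ dist x y :=
    h₂.trans (mul_le_of_le_one_left dist_nonneg S.inv_lam_lt_one.le)
  refine ⟨h₂.trans_lt (mul_lt_mul_of_pos_left hy.1 (inv_pos.2 S.lam_pos)), ?_⟩
  rw [S.bracket_map y x (by rwa [dist_comm]) (by rw [dist_comm]; exact h₃.trans_lt h₁), hy.2]

lemma iterate_mem_localStable {x y : X} {δ : ℝ} (h0 : 0 ≤ δ) (hδ : δ ≤ S.eps)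
    (hy : y ∈ S.localStable x δ) (n : ℕ) :
    S.φ^[n] y ∈ S.localStable (S.φ^[n] x) (S.lam⁻¹ ^ n * δ) := by
  induction n with
  | zero => simpa using hy
  | succ n ih =>
    rw [Function.iterate_succ_apply', Function.iterate_succ_apply', pow_succ', mul_assoc]
    refine map_mem_localStable (le_trans ?_ hδ) ih
    exact mul_le_of_le_one_left h0 (pow_le_one₀ S.inv_lam_nonneg S.inv_lam_lt_one.le)

lemma iterate_mem_localStable' {x y : X} {δ : ℝ} (hδ : δ ≤ S.eps)
    (hy : y ∈ S.localStable x δ) (n : ℕ) : S.φ^[n] y ∈ S.localStable (S.φ^[n] x) δ := by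
  have h0 : 0 ≤ δ := dist_nonneg.trans hy.1.le
  exact localStable_mono (mul_le_of_le_one_left h0
    (pow_le_one₀ S.inv_lam_nonneg S.inv_lam_lt_one.le)) (iterate_mem_localStable h0 hδ hy n)

lemma tendsto_inv_lam_pow_mul (c : ℝ) : Tendsto (fun n : ℕ => S.lam⁻¹ ^ n * c) atTop (𝓝 0) := by
  simpa using (tendsto_pow_atTop_nhds_zero_of_lt_one S.inv_lam_nonneg
    S.inv_lam_lt_one).mul_const c

lemma stableEquiv_of_mem_localStable {x y : X} (hy : y ∈ S.localStable x S.eps) :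
    S.StableEquiv x y :=
  squeeze_zero (fun _ => dist_nonneg)
    (fun n => (iterate_mem_localStable S.eps_pos.le le_rfl hy n).1.le)
    (tendsto_inv_lam_pow_mul S.eps)

lemma StableEquiv.symm {x y : X} (h : S.StableEquiv x y) : S.StableEquiv y x := by
  refine Tendsto.congr (fun n => ?_) h
  exact dist_comm _ _

lemma StableEquiv.trans {x y z : X} (h : S.StableEquiv x y) (h' : S.StableEquiv y z) :
    S.StableEquiv x z := by
  refine squeeze_zero (fun _ => dist_nonneg) (fun n => dist_triangle _ (S.φ^[n] y) _) ?_
  simpa using Tendsto.add h h'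

lemma StableEquiv.refl (x : X) : S.StableEquiv x x := by
  simp [StableEquiv]

lemma stableEquiv_map_iff {x y : X} : S.StableEquiv (S.φ x) (S.φ y) ↔ S.StableEquiv x y := by
  unfold StableEquiv
  simp only [← Function.iterate_succ_apply]
  exact tendsto_add_atTop_iff_nat (f := fun n => dist (S.φ^[n] x) (S.φ^[n] y)) 1

lemma self_mem_localUnstable {x : X} {δ : ℝ} (hδ : 0 < δ) : x ∈ S.localUnstable x δ :=
  self_mem_localStable (S := S.inv) hδ

lemma localUnstable_mono {x : X} {δ δ' : ℝ} (h : δ ≤ δ') :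
    S.localUnstable x δ ⊆ S.localUnstable x δ' :=
  localStable_mono (S := S.inv) h

lemma mem_localUnstable_comm {x y : X} {δ : ℝ} (hδ : δ ≤ S.eps) :
    y ∈ S.localUnstable x δ ↔ x ∈ S.localUnstable y δ :=
  mem_localStable_comm (S := S.inv) hδ

lemma localUnstable_trans {x y z : X} {δ : ℝ} (hy : y ∈ S.localUnstable x S.eps)
    (hz : z ∈ S.localUnstable y S.eps) (hδ : δ ≤ S.eps) (h : dist x z < δ) :
    z ∈ S.localUnstable x δ :=
  localStable_trans (S := S.inv) hy hz hδ h

/-- Two points of one local stable leaf that also lie on one local unstable leaf coincide. -/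
lemma eq_of_mem_localStable_of_mem_localUnstable {x y : X} (hs : y ∈ S.localStable x S.eps)
    (hu : y ∈ S.localUnstable x S.eps) : x = y :=
  hu.2.symm.trans ((mem_localStable_comm le_rfl).1 hs).2

lemma unstableEquiv_of_mem_localUnstable {x y : X} (hy : y ∈ S.localUnstable x S.eps) :
    S.UnstableEquiv x y :=
  stableEquiv_of_mem_localStable (S := S.inv) hy

lemma UnstableEquiv.symm {x y : X} (h : S.UnstableEquiv x y) : S.UnstableEquiv y x :=
  StableEquiv.symm (S := S.inv) h

lemma UnstableEquiv.trans {x y z : X} (h : S.UnstableEquiv x y) (h' : S.UnstableEquiv y z) :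
    S.UnstableEquiv x z :=
  StableEquiv.trans (S := S.inv) h h'

lemma unstableEquiv_map_iff {x y : X} :
    S.UnstableEquiv (S.φ x) (S.φ y) ↔ S.UnstableEquiv x y := by
  have h := stableEquiv_map_iff (S := S.inv) (x := S.φ x) (y := S.φ y)
  have e : ∀ z, S.inv.φ (S.φ z) = z := S.φ.symm_apply_apply
  rw [e, e] at h
  exact h.symm

/-- The bracket is close to its arguments near the diagonal. -/
lemma exists_dist_bracket_lt (S : SmaleSpace X) {r : ℝ} (hr : 0 < r) :
    ∃ η > 0, η ≤ S.eps ∧ ∀ x y, dist x y < η → dist (S.bracket x y) y < r := by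
  have hopen : IsOpen {q : X × X | dist q.1 q.2 < S.eps} :=
    isOpen_lt continuous_dist continuous_const
  have hV : {q : X × X | dist (S.bracket q.1 q.2) q.2 < r} ∈ uniformity X := by
    rw [compactSpace_uniformity]
    refine mem_iSup.2 fun x => ?_
    have hc : ContinuousAt (fun q : X × X => S.bracket q.1 q.2) (x, x) :=
      S.continuousOn_bracket.continuousAt
        (hopen.mem_nhds (by change dist x x < S.eps; simpa using S.eps_pos))
    have hd : ContinuousAt (fun q : X × X => dist (S.bracket q.1 q.2) q.2) (x, x) :=
      hc.dist continuousAt_snd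
    refine hd.eventually_lt continuousAt_const ?_
    simpa [S.bracket_self] using hr
  obtain ⟨η, hη, h⟩ := Metric.mem_uniformity_dist.1 hV
  exact ⟨min η S.eps, lt_min hη S.eps_pos, min_le_right _ _,
    fun x y hxy => h (hxy.trans_le (min_le_left _ _))⟩

lemma bracket_iterate {x y : X} {n : ℕ}
    (h : ∀ k ≤ n, dist (S.φ^[k] x) (S.φ^[k] y) < S.eps) :
    S.bracket (S.φ^[n] x) (S.φ^[n] y) = S.φ^[n] (S.bracket x y) := by
  induction n with
  | zero => rfl
  | succ n ih =>
    have h₁ := h n n.le_succ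
    have h₂ := h (n + 1) le_rfl
    rw [Function.iterate_succ_apply'] at h₂ ⊢
    rw [Function.iterate_succ_apply'] at h₂ ⊢
    rw [Function.iterate_succ_apply', S.bracket_map _ _ h₁ h₂,
      ih fun k hk => h k (hk.trans n.le_succ)]

lemma iterate_mem_localUnstable {x y : X} {δ δ' : ℝ} {n : ℕ} (hy : y ∈ S.localUnstable x δ)
    (h : ∀ k ≤ n, dist (S.φ^[k] x) (S.φ^[k] y) < S.eps)
    (hn : dist (S.φ^[n] x) (S.φ^[n] y) < δ') :
    S.φ^[n] y ∈ S.localUnstable (S.φ^[n] x) δ' :=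
  ⟨hn, by rw [bracket_iterate h, hy.2]⟩

/-- Points whose forward orbits stay close lie on one local stable leaf: the difference between
`y` and `[x, y]` lies along the unstable leaf of `y`, where it would grow exponentially. -/
lemma exists_bracket_eq_of_forward_close (S : SmaleSpace X) :
    ∃ η > 0, η ≤ S.eps ∧ ∀ x y, (∀ n : ℕ, dist (S.φ^[n] x) (S.φ^[n] y) < η) →
      S.bracket x y = y := by
  obtain ⟨η, hη, hηe, H⟩ := S.exists_dist_bracket_lt S.eps_pos
  refine ⟨η, hη, hηe, fun x y hxy => ?_⟩
  set c : ℕ → X := fun n => S.φ^[n] (S.bracket x y) with hc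
  have hcb : ∀ n, c n = S.bracket (S.φ^[n] x) (S.φ^[n] y) := fun n =>
    (bracket_iterate fun k _ => (hxy k).trans_le hηe).symm
  have hd : ∀ n, dist (S.φ^[n] y) (c n) < S.eps := fun n => by
    rw [hcb, dist_comm]
    exact H _ _ (hxy n)
  have hu : ∀ n, S.bracket (S.φ^[n] y) (c n) = S.φ^[n] y := fun n => by
    have := S.bracket_right (S.φ^[n] y) (S.φ^[n] x) (S.φ^[n] y) ((hxy n).trans_le hηe)
      (by rw [← hcb]; exact hd n) (by simpa using S.eps_pos)
    rw [hcb, this, S.bracket_self]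
  have hstep : ∀ n, dist (S.φ^[n] y) (c n) ≤ S.lam⁻¹ * dist (S.φ^[n + 1] y) (c (n + 1)) := by
    intro n
    have := S.contract_unstable _ _ (hd (n + 1)) (hu (n + 1))
    simpa only [hc, Function.iterate_succ_apply', Homeomorph.symm_apply_apply] using this
  have hbound : ∀ n, dist y (c 0) ≤ S.lam⁻¹ ^ n * dist (S.φ^[n] y) (c n) := by
    intro n
    induction n with
    | zero => simp
    | succ n ih =>
      refine ih.trans ?_
      rw [pow_succ, mul_assoc]
      exact mul_le_mul_of_nonneg_left (hstep n) (pow_nonneg S.inv_lam_nonneg _)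
  have h0 : dist y (c 0) ≤ 0 :=
    ge_of_tendsto' (tendsto_inv_lam_pow_mul (S := S) S.eps) fun n => (hbound n).trans
      (mul_le_mul_of_nonneg_left (hd n).le (pow_nonneg S.inv_lam_nonneg _))
  exact (dist_le_zero.1 h0).symm

lemma StableEquiv.eventually_mem_localStable {x y : X} (h : S.StableEquiv x y) {δ : ℝ}
    (hδ : 0 < δ) : ∀ᶠ n in atTop, S.φ^[n] y ∈ S.localStable (S.φ^[n] x) δ := by
  obtain ⟨η, hη, hηe, H⟩ := S.exists_bracket_eq_of_forward_close
  obtain ⟨N, hN⟩ := eventually_atTop.1 (h.eventually_lt_const (lt_min hη hδ))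
  filter_upwards [eventually_ge_atTop N] with n hn
  refine ⟨(hN n hn).trans_le (min_le_right _ _), H _ _ fun k => ?_⟩
  rw [← Function.iterate_add_apply, ← Function.iterate_add_apply, dist_comm]
  exact (hN _ (le_add_left hn)).trans_le (min_le_left _ _)

/-- Stably equivalent periodic points coincide. -/
lemma StableEquiv.eq_of_periodic {x y : X} (h : S.StableEquiv x y)
    (hx : x ∈ Function.periodicPts S.φ) (hy : y ∈ Function.periodicPts S.φ) : x = y := by
  obtain ⟨m, hm, hxm⟩ := hx
  obtain ⟨k, hk, hyk⟩ := hy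
  have ht : Tendsto (fun n : ℕ => n * (m * k)) atTop atTop :=
    tendsto_id.atTop_mul_const' (Nat.mul_pos hm hk)
  have h0 := Tendsto.comp h ht
  have e : ((fun n => dist (S.φ^[n] x) (S.φ^[n] y)) ∘ fun n : ℕ => n * (m * k))
      = fun _ => dist x y := by
    funext n
    have h₁ : S.φ^[n * (m * k)] x = x := by
      have := hxm.const_mul (n * k)
      rw [show n * (m * k) = n * k * m by ring]
      exact this
    have h₂ : S.φ^[n * (m * k)] y = y := by
      have := hyk.const_mul (n * m)
      rw [show n * (m * k) = n * m * k by ring]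
      exact this
    simp only [Function.comp, h₁, h₂]
  rw [e] at h0
  exact dist_eq_zero.1 (tendsto_nhds_unique tendsto_const_nhds h0)

lemma mem_periodicPts_symm {x : X} (hx : x ∈ Function.periodicPts S.φ) :
    x ∈ Function.periodicPts S.φ.symm := by
  obtain ⟨m, hm, h⟩ := hx
  refine ⟨m, hm, ?_⟩
  have := Function.LeftInverse.iterate S.φ.symm_apply_apply m x
  rwa [h] at this

lemma UnstableEquiv.eq_of_periodic {x y : X} (h : S.UnstableEquiv x y)
    (hx : x ∈ Function.periodicPts S.φ) (hy : y ∈ Function.periodicPts S.φ) : x = y :=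
  StableEquiv.eq_of_periodic (S := S.inv) h (mem_periodicPts_symm hx) (mem_periodicPts_symm hy)

/-- The number of points of a local unstable set that enter a local stable set after `n` steps
grows at most exponentially in `n`. Two such points with the same itinerary through a cover of
`X` by sets of diameter less than `ε_X` coincide. -/
lemma exists_card_le_pow (S : SmaleSpace X) :
    ∃ M : ℕ, ∀ (v p : X) (n : ℕ) (F : Finset X),
      (∀ x ∈ F, x ∈ S.localUnstable v (S.eps / 2) ∧ S.φ^[n] x ∈ S.localStable p (S.eps / 2)) →
      F.card ≤ M ^ (n + 1) := by
  classical
  obtain ⟨t, -, htf, ht⟩ := (isCompact_univ (X := X)).finite_cover_balls (half_pos S.eps_pos)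
  have hex : ∀ x : X, ∃ c : htf.toFinset, dist x c < S.eps / 2 := fun x => by
    obtain ⟨c, hc, hx⟩ := mem_iUnion₂.1 (ht (mem_univ x))
    exact ⟨⟨c, htf.mem_toFinset.2 hc⟩, hx⟩
  choose c hc using hex
  refine ⟨Fintype.card htf.toFinset, fun v p n F hF => ?_⟩
  have he := S.eps_pos
  have hinj : Set.InjOn (fun (x : X) (k : Fin (n + 1)) => c (S.φ^[k] x)) F := by
    intro x hx y hy hxy
    have hk : ∀ k ≤ n, dist (S.φ^[k] x) (S.φ^[k] y) < S.eps := fun k hk => by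
      have h₁ := hc (S.φ^[k] x)
      have h₂ := hc (S.φ^[k] y)
      have e : c (S.φ^[k] x) = c (S.φ^[k] y) := congrFun hxy ⟨k, Nat.lt_succ_of_le hk⟩
      rw [e] at h₁
      have := dist_triangle_right (S.φ^[k] x) (S.φ^[k] y) (c (S.φ^[k] y))
      linarith
    have hxu := localUnstable_mono (by linarith : S.eps / 2 ≤ S.eps) (hF x hx).1
    have hyu := localUnstable_mono (by linarith : S.eps / 2 ≤ S.eps) (hF y hy).1
    have hxs := localStable_mono (by linarith : S.eps / 2 ≤ S.eps) (hF x hx).2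
    have hys := localStable_mono (by linarith : S.eps / 2 ≤ S.eps) (hF y hy).2
    have hu : y ∈ S.localUnstable x S.eps :=
      localUnstable_trans ((mem_localUnstable_comm le_rfl).1 hxu) hyu le_rfl (hk 0 n.zero_le)
    have hs : S.φ^[n] y ∈ S.localStable (S.φ^[n] x) S.eps :=
      localStable_trans ((mem_localStable_comm le_rfl).1 hxs) hys le_rfl (hk n le_rfl)
    have := eq_of_mem_localStable_of_mem_localUnstable hs
      (iterate_mem_localUnstable hu hk (hk n le_rfl))
    exact S.φ.injective.iterate n this
  calc F.card ≤ (Finset.univ : Finset (Fin (n + 1) → htf.toFinset)).card :=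
        Finset.card_le_card_of_injOn _ (fun _ _ => Finset.mem_univ _) hinj
    _ = _ := by simp

end Dynamics

end SmaleSpace

namespace SmaleSpace

section EntryTime

variable {X : Type*} [MetricSpace X] [CompactSpace X] {S : SmaleSpace X} {P Q : Set X}

/-! ### Heteroclinic points and entry times -/

lemma zpow_natCast_apply (S : SmaleSpace X) (n : ℕ) (x : X) : (S.φ ^ (n : ℤ)) x = S.φ^[n] x := by
  rw [zpow_natCast]
  induction n with
  | zero => rfl
  | succ n ih => rw [pow_succ', Function.iterate_succ_apply', ← ih]; rfl

lemma zpow_neg_natCast_apply (S : SmaleSpace X) (n : ℕ) (x : X) :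
    (S.φ ^ (-(n : ℤ))) x = S.φ.symm^[n] x := by
  have h₁ : S.φ^[n] (S.φ.symm^[n] x) = x :=
    Function.LeftInverse.iterate (fun y => S.φ.apply_symm_apply y) n x
  have h₂ : (S.φ ^ (n : ℤ)) ((S.φ ^ (-(n : ℤ))) x) = x := by
    rw [← Homeomorph.mul_apply, ← zpow_add]
    simp
  rw [zpow_natCast_apply] at h₂
  exact S.φ.injective.iterate n (h₂.trans h₁.symm)

lemma zpow_add_apply (S : SmaleSpace X) (m n : ℤ) (x : X) :
    (S.φ ^ (m + n)) x = (S.φ ^ m) ((S.φ ^ n) x) := by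
  rw [zpow_add]; rfl

lemma mapsTo_symm_of_finite (hfin : P.Finite) (hinv : MapsTo S.φ P P) :
    MapsTo S.φ.symm P P := by
  have := ((hfin.injOn_iff_bijOn_of_mapsTo hinv).1 S.φ.injective.injOn).surjOn
  intro p hp
  obtain ⟨q, hq, rfl⟩ := this hp
  simpa using hq

lemma map_mem_stableSet_iff (hfin : P.Finite) (hinv : MapsTo S.φ P P) {x : X} :
    S.φ x ∈ S.stableSet P ↔ x ∈ S.stableSet P := by
  constructor
  · rintro ⟨p, hp, h⟩
    refine ⟨S.φ.symm p, mapsTo_symm_of_finite hfin hinv hp, ?_⟩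
    rwa [← stableEquiv_map_iff, Homeomorph.apply_symm_apply]
  · rintro ⟨p, hp, h⟩
    exact ⟨S.φ p, hinv hp, stableEquiv_map_iff.2 h⟩

lemma map_mem_unstableSet_iff (hfin : Q.Finite) (hinv : MapsTo S.φ Q Q) {x : X} :
    S.φ x ∈ S.unstableSet Q ↔ x ∈ S.unstableSet Q := by
  constructor
  · rintro ⟨p, hp, h⟩
    refine ⟨S.φ.symm p, mapsTo_symm_of_finite hfin hinv hp, ?_⟩
    rwa [← unstableEquiv_map_iff, Homeomorph.apply_symm_apply]
  · rintro ⟨p, hp, h⟩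
    exact ⟨S.φ p, hinv hp, unstableEquiv_map_iff.2 h⟩

lemma zpow_mem_iff {A : Set X} (h : ∀ x, S.φ x ∈ A ↔ x ∈ A) (n : ℤ) (x : X) :
    (S.φ ^ n) x ∈ A ↔ x ∈ A := by
  have key : ∀ (n : ℕ) (x : X), S.φ^[n] x ∈ A ↔ x ∈ A := fun n => by
    induction n with
    | zero => exact fun x => Iff.rfl
    | succ n ih => exact fun x => by rw [Function.iterate_succ_apply, ih, h]
  obtain ⟨m, rfl | rfl⟩ := n.eq_nat_or_neg
  · rw [zpow_natCast_apply, key]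
  · rw [zpow_neg_natCast_apply, ← key m,
      Function.LeftInverse.iterate (fun y => S.φ.apply_symm_apply y) m x]

variable (S P Q) in
/-- The standing assumptions: `P` and `Q` are finite `φ`-invariant sets of periodic points, and
they are disjoint. -/
structure IsPeriodicPair : Prop where
  finite_left : P.Finite
  finite_right : Q.Finite
  periodic_left : P ⊆ Function.periodicPts S.φ
  periodic_right : Q ⊆ Function.periodicPts S.φ
  mapsTo_left : MapsTo S.φ P P
  mapsTo_right : MapsTo S.φ Q Q
  disjoint : Disjoint P Q

lemma IsPeriodicPair.zpow_mem_stableSet_iff (h : S.IsPeriodicPair P Q) (n : ℤ) (x : X) :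
    (S.φ ^ n) x ∈ S.stableSet P ↔ x ∈ S.stableSet P :=
  zpow_mem_iff (fun _ => map_mem_stableSet_iff h.finite_left h.mapsTo_left) n x

lemma IsPeriodicPair.zpow_mem_heteroclinic_iff (h : S.IsPeriodicPair P Q) (n : ℤ) (x : X) :
    (S.φ ^ n) x ∈ S.heteroclinic P Q ↔ x ∈ S.heteroclinic P Q :=
  zpow_mem_iff (A := S.heteroclinic P Q) (fun _ => and_congr
    (map_mem_stableSet_iff h.finite_left h.mapsTo_left)
    (map_mem_unstableSet_iff h.finite_right h.mapsTo_right)) n x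

lemma IsPeriodicPair.notMem_left (h : S.IsPeriodicPair P Q) {x : X}
    (hx : x ∈ S.heteroclinic P Q) : x ∉ P := by
  intro hxP
  obtain ⟨q, hq, hqx⟩ := hx.2
  have := UnstableEquiv.eq_of_periodic hqx (h.periodic_right hq) (h.periodic_left hxP)
  exact h.disjoint.le_bot ⟨hxP, this ▸ hq⟩

lemma mem_localStableSet {ε : ℝ} {x : X} :
    x ∈ S.localStableSet P ε ↔ ∃ p ∈ P, x ∈ S.localStable p ε := by
  simp [localStableSet]

lemma iterate_mem_localStableSet {ε : ℝ} (hε : ε ≤ S.eps) (hinv : MapsTo S.φ P P) {x : X}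
    (hx : x ∈ S.localStableSet P ε) (n : ℕ) :
    ∃ p ∈ P, S.φ^[n] x ∈ S.localStable p (S.lam⁻¹ ^ n * ε) := by
  obtain ⟨p, hp, h⟩ := mem_localStableSet.1 hx
  exact ⟨S.φ^[n] p, hinv.iterate n hp,
    iterate_mem_localStable (dist_nonneg.trans h.1.le) hε h n⟩

lemma zpow_mem_localStableSet_mono {ε : ℝ} (hε : ε ≤ S.eps) (hinv : MapsTo S.φ P P) {x : X}
    {m n : ℤ} (hmn : m ≤ n) (hx : (S.φ ^ m) x ∈ S.localStableSet P ε) :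
    (S.φ ^ n) x ∈ S.localStableSet P ε := by
  obtain ⟨k, rfl⟩ := Int.le.dest hmn
  rw [add_comm, zpow_add_apply, zpow_natCast_apply]
  obtain ⟨p, hp, h⟩ := mem_localStableSet.1 hx
  exact mem_localStableSet.2 ⟨S.φ^[k] p, hinv.iterate k hp, iterate_mem_localStable' hε h k⟩

variable (S P) in
/-- The entry time of `x`: the least `n ∈ ℤ` with `φⁿ(x) ∈ X^s(P, ε)`. The infimum is attained
for `x ∈ X^s(P) \ P`; for other `x` the value may be the junk value of `sInf`. -/
noncomputable def entryTime (ε : ℝ) (x : X) : ℤ :=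
  sInf {n : ℤ | (S.φ ^ n) x ∈ S.localStableSet P ε}

lemma entryTime_zpow (ε : ℝ) (x : X) (k : ℤ) (hne : ∀ n : ℤ,
    (S.φ ^ n) x ∈ S.localStableSet P ε ↔ S.entryTime P ε x ≤ n) :
    S.entryTime P ε ((S.φ ^ k) x) = S.entryTime P ε x - k := by
  have : {n : ℤ | (S.φ ^ n) ((S.φ ^ k) x) ∈ S.localStableSet P ε}
      = Ici (S.entryTime P ε x - k) := by
    ext n
    rw [mem_ofPred_eq, ← zpow_add_apply, hne, mem_Ici]
    omega
  rw [entryTime, this, csInf_Ici]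

/-- A heteroclinic point lies in `X^s(P, ε)` from its entry time on, and not before: under
`φ⁻¹` it cannot stay in `X^s(P, ε)`, since it would then be arbitrarily close to `P`. -/
lemma IsPeriodicPair.zpow_mem_localStableSet_iff (h : S.IsPeriodicPair P Q) {ε : ℝ} (h0 : 0 < ε)
    (hε : ε ≤ S.eps) {x : X} (hx : x ∈ S.heteroclinic P Q) (n : ℤ) :
    (S.φ ^ n) x ∈ S.localStableSet P ε ↔ S.entryTime P ε x ≤ n := by
  have hne : {n : ℤ | (S.φ ^ n) x ∈ S.localStableSet P ε}.Nonempty := by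
    obtain ⟨p, hp, hpx⟩ := hx.1
    obtain ⟨N, hN⟩ := (hpx.eventually_mem_localStable h0).exists
    refine ⟨N, ?_⟩
    rw [mem_ofPred_eq, zpow_natCast_apply]
    exact mem_localStableSet.2 ⟨_, h.mapsTo_left.iterate N hp, hN⟩
  have hbdd : BddBelow {n : ℤ | (S.φ ^ n) x ∈ S.localStableSet P ε} := by
    by_contra hb
    refine h.notMem_left hx ?_
    rw [← h.finite_left.isClosed.closure_eq, Metric.mem_closure_iff]
    intro r hr
    obtain ⟨k, hk⟩ := ((tendsto_inv_lam_pow_mul (S := S) ε).eventually_lt_const hr).exists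
    rw [not_bddBelow_iff] at hb
    obtain ⟨m, hm, hmk⟩ := hb (-k)
    have hk' : (S.φ ^ (-(k : ℤ))) x ∈ S.localStableSet P ε :=
      zpow_mem_localStableSet_mono hε h.mapsTo_left hmk.le hm
    obtain ⟨p, hp, hpx⟩ := iterate_mem_localStableSet hε h.mapsTo_left hk' k
    rw [← zpow_natCast_apply, ← zpow_add_apply] at hpx
    simp only [add_neg_cancel, zpow_zero] at hpx
    exact ⟨p, hp, by rw [dist_comm]; exact hpx.1.trans hk⟩
  constructor
  · exact fun hn => csInf_le hbdd hn
  · exact fun hn => zpow_mem_localStableSet_mono hε h.mapsTo_left hn (Int.csInf_mem hne hbdd)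

/-- `ω_s` differs from the entry time by at most `1`. In the two sums of `ω_s` only the term
at time `entryTime - 1` can be different from `0` and `1`. -/
lemma IsPeriodicPair.omegaS_mem_Icc (h : S.IsPeriodicPair P Q) {ε : ℝ} (h0 : 0 < ε)
    (hε : ε ≤ S.eps) {ω₀ : X → ℝ} (hω₀ : S.IsCutoff P ε ω₀) {x : X}
    (hx : x ∈ S.heteroclinic P Q) :
    S.omegaS ω₀ x ∈ Icc ((S.entryTime P ε x : ℝ) - 1) (S.entryTime P ε x) := by
  set τ := S.entryTime P ε x with hτ
  have hiff := fun n : ℤ => h.zpow_mem_localStableSet_iff h0 hε hx n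
  have hP : ∀ n : ℤ, (S.φ ^ n) x ∈ S.stableSet P := fun n =>
    (h.zpow_mem_stableSet_iff n x).2 hx.1
  have hz : ∀ n : ℤ, τ ≤ n → ω₀ ((S.φ ^ n) x) = 0 := fun n hn =>
    hω₀.eq_zero _ (hP n) (@subset_closure X S.stableTopology _ _ ((hiff n).2 hn))
  have ho : ∀ n : ℤ, n + 1 < τ → ω₀ ((S.φ ^ n) x) = 1 := fun n hn => by
    refine hω₀.eq_one _ (hP n) fun hmem => ?_
    have e : S.φ ((S.φ ^ n) x) = (S.φ ^ (n + 1)) x := by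
      rw [add_comm, zpow_add_apply, zpow_one]
    rw [e, hiff] at hmem
    omega
  have hI := hω₀.mem_Icc _ (hP (τ - 1))
  have hu : ∀ n : ℕ, ω₀ (S.φ^[n] x) = ω₀ ((S.φ ^ (n : ℤ)) x) := fun n => by
    rw [zpow_natCast_apply]
  have hv : ∀ n : ℕ, ω₀ (S.φ.symm^[n + 1] x) = ω₀ ((S.φ ^ (-((n : ℤ) + 1))) x) := fun n => by
    rw [← zpow_neg_natCast_apply]; push_cast; rfl
  unfold omegaS
  simp only [hu, hv]
  rcases lt_or_ge 0 τ with hpos | hneg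
  · obtain ⟨m, hm⟩ : ∃ m : ℕ, τ = m + 1 := ⟨(τ - 1).toNat, by omega⟩
    have h₁ : ∑' n : ℕ, ω₀ ((S.φ ^ (n : ℤ)) x) = m + ω₀ ((S.φ ^ (τ - 1)) x) := by
      rw [tsum_eq_sum (s := Finset.range (m + 1)), Finset.sum_range_succ,
        Finset.sum_congr rfl (g := fun _ => (1 : ℝ))]
      · simp [hm]
      · intro n hn
        exact ho _ (by rw [Finset.mem_range] at hn; omega)
      · intro n hn
        exact hz _ (by rw [Finset.mem_range] at hn; omega)
    have h₂ : ∑' n : ℕ, (1 - ω₀ ((S.φ ^ (-((n : ℤ) + 1))) x)) = 0 := by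
      rw [← tsum_zero (α := ℝ) (β := ℕ)]
      congr 1
      funext n
      rw [ho _ (by omega), sub_self]
    have hmR : (τ : ℝ) = m + 1 := by rw [hm]; push_cast; rfl
    rw [h₁, h₂, hmR]
    constructor <;> linarith [hI.1, hI.2]
  · obtain ⟨m, hm⟩ : ∃ m : ℕ, τ = -m := ⟨(-τ).toNat, by omega⟩
    have h₁ : ∑' n : ℕ, ω₀ ((S.φ ^ (n : ℤ)) x) = 0 := by
      rw [← tsum_zero (α := ℝ) (β := ℕ)]
      congr 1
      funext n
      exact hz _ (by omega)
    have h₂ : ∑' n : ℕ, (1 - ω₀ ((S.φ ^ (-((n : ℤ) + 1))) x))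
        = m + (1 - ω₀ ((S.φ ^ (τ - 1)) x)) := by
      rw [tsum_eq_sum (s := Finset.range (m + 1)), Finset.sum_range_succ,
        Finset.sum_congr rfl (g := fun _ => (1 : ℝ))]
      · have e : -((m : ℤ) + 1) = τ - 1 := by omega
        simp [e]
      · intro n hn
        rw [hz _ (by rw [Finset.mem_range] at hn; omega), sub_zero]
      · intro n hn
        rw [ho _ (by rw [Finset.mem_range] at hn; omega), sub_self]
    have hmR : (τ : ℝ) = -m := by rw [hm]; push_cast; rfl
    rw [h₁, h₂, hmR]
    constructor <;> linarith [hI.1, hI.2]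

/-! ### Counting heteroclinic points in a local unstable set -/

variable (S) in
/-- The union of the local unstable sets `X^u(v, ε_X / 2)`, `v ∈ t`. Compact subsets of `X^u(Q)`
lie in such sets with `t` finite. -/
def leafCover (t : Finset X) : Set X := ⋃ v ∈ t, S.localUnstable v (S.eps / 2)

lemma mem_leafCover {t : Finset X} {x : X} :
    x ∈ S.leafCover t ↔ ∃ v ∈ t, x ∈ S.localUnstable v (S.eps / 2) := by
  simp [leafCover]

lemma leafCover_mono {t t' : Finset X} (h : t ⊆ t') : S.leafCover t ⊆ S.leafCover t' :=
  biUnion_subset_biUnion_left h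

lemma IsPeriodicPair.exists_card_le (h : S.IsPeriodicPair P Q) {ε : ℝ} (h0 : 0 < ε)
    (hε : ε ≤ S.eps / 2) (t : Finset X) :
    ∃ C M : ℕ, ∀ (n : ℕ) (F : Finset X), (∀ x ∈ F, x ∈ S.heteroclinic P Q ∧ x ∈ S.leafCover t ∧
      S.entryTime P ε x ≤ n) → F.card ≤ C * M ^ (n + 1) := by
  classical
  obtain ⟨M, hM⟩ := S.exists_card_le_pow
  have he := S.eps_pos
  refine ⟨(t ×ˢ h.finite_left.toFinset).card, M, fun n F hF => ?_⟩
  have hsub : F ⊆ (t ×ˢ h.finite_left.toFinset).biUnion fun vp =>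
      F.filter fun x => x ∈ S.localUnstable vp.1 (S.eps / 2) ∧
        S.φ^[n] x ∈ S.localStable vp.2 (S.eps / 2) := by
    intro x hx
    obtain ⟨hx₁, hx₂, hx₃⟩ := hF x hx
    obtain ⟨v, hv, hxv⟩ := mem_leafCover.1 hx₂
    have := (h.zpow_mem_localStableSet_iff h0 (by linarith) hx₁ n).2 hx₃
    rw [zpow_natCast_apply] at this
    obtain ⟨p, hp, hxp⟩ := mem_localStableSet.1 this
    exact Finset.mem_biUnion.2 ⟨(v, p),
      Finset.mem_product.2 ⟨hv, h.finite_left.mem_toFinset.2 hp⟩,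
      Finset.mem_filter.2 ⟨hx, hxv, localStable_mono hε hxp⟩⟩
  refine (Finset.card_le_card hsub).trans (Finset.card_biUnion_le_card_mul _ _ _ fun vp _ => ?_)
  exact hM vp.1 vp.2 n _ fun x hx => (Finset.mem_filter.1 hx).2

/-- Only finitely many heteroclinic points in a compact part of `X^u(Q)` have entered
`X^s(P, ε)` by a given time. -/
lemma IsPeriodicPair.finite_entryTime_le (h : S.IsPeriodicPair P Q) {ε : ℝ} (h0 : 0 < ε)
    (hε : ε ≤ S.eps / 2) (t : Finset X) (n : ℤ) :
    {x | x ∈ S.heteroclinic P Q ∧ x ∈ S.leafCover t ∧ S.entryTime P ε x ≤ n}.Finite := by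
  obtain ⟨C, M, H⟩ := h.exists_card_le h0 hε t
  by_contra hinf
  obtain ⟨F, hF, hcard⟩ := (show Set.Infinite _ from hinf).exists_subset_card_eq
    (C * M ^ (n.toNat + 1) + 1)
  have := H n.toNat F fun x hx => by
    obtain ⟨h₁, h₂, h₃⟩ := hF hx
    exact ⟨h₁, h₂, h₃.trans (Int.self_le_toNat n)⟩
  omega

lemma IsPeriodicPair.exists_le_entryTime (h : S.IsPeriodicPair P Q) {ε : ℝ} (h0 : 0 < ε)
    (hε : ε ≤ S.eps / 2) (t : Finset X) :
    ∃ L : ℕ, ∀ x ∈ S.heteroclinic P Q, x ∈ S.leafCover t → -(L : ℤ) ≤ S.entryTime P ε x := by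
  obtain ⟨b, hb⟩ := ((h.finite_entryTime_le h0 hε t 0).image (S.entryTime P ε)).bddBelow
  refine ⟨b.natAbs, fun x hx hxt => ?_⟩
  rcases le_or_gt (S.entryTime P ε x) 0 with h' | h'
  · have := hb (mem_image_of_mem _ ⟨hx, hxt, h'⟩)
    omega
  · omega

/-- `X^h(P, Q)` is countable: `X^u(Q)` is the union of the sets `φᵏ(X^u(q, ε_X / 2))`. -/
lemma IsPeriodicPair.countable_heteroclinic (h : S.IsPeriodicPair P Q) :
    (S.heteroclinic P Q).Countable := by
  have he := half_pos S.eps_pos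
  have hc : {x | x ∈ S.heteroclinic P Q ∧ x ∈ S.leafCover h.finite_right.toFinset}.Countable := by
    refine (countable_iUnion fun n : ℤ =>
      (h.finite_entryTime_le he le_rfl h.finite_right.toFinset n).countable).mono ?_
    exact fun x hx => mem_iUnion.2 ⟨S.entryTime P (S.eps / 2) x, hx.1, hx.2, le_rfl⟩
  refine (countable_iUnion fun k : ℕ => hc.image (S.φ ^ (k : ℤ))).mono fun x hx => ?_
  obtain ⟨q, hq, hqx⟩ := hx.2
  obtain ⟨k, hk⟩ := (StableEquiv.eventually_mem_localStable (S := S.inv) hqx he).exists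
  refine mem_iUnion.2 ⟨k, (S.φ ^ (-(k : ℤ))) x, ⟨(h.zpow_mem_heteroclinic_iff _ _).2 hx, ?_⟩, ?_⟩
  · refine mem_leafCover.2 ⟨S.φ.symm^[k] q, h.finite_right.mem_toFinset.2
      ((mapsTo_symm_of_finite h.finite_right h.mapsTo_right).iterate k hq), ?_⟩
    rw [zpow_neg_natCast_apply]
    exact hk
  · rw [← zpow_add_apply]
    simp

/-- On a compact part of `X^u(Q)` the number of points with `ω_s(x) ≤ n` grows at most
exponentially, so that `e^{-t(1 + ω_s²)}` is summable there. -/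
lemma IsPeriodicPair.summable_exp (h : S.IsPeriodicPair P Q) {ε : ℝ} (h0 : 0 < ε)
    (hε : ε ≤ S.eps / 2) {ω₀ : X → ℝ} (hω₀ : S.IsCutoff P ε ω₀) (t : Finset X) {s : ℝ}
    (hs : 0 < s) :
    Summable fun x : S.heteroclinic P Q =>
      (S.leafCover t).indicator (fun x => Real.exp (-s * (1 + S.omegaS ω₀ x ^ 2))) x := by
  classical
  obtain ⟨C, M, H⟩ := h.exists_card_le h0 hε t
  have he := S.eps_pos
  set K : ℝ := C * Real.exp (s + 2 * M + 1 + (M + 1) ^ 2 / (4 * s)) with hK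
  -- The Gaussian factor absorbs the exponential count: complete the square in `n - 1`.
  have hgauss : ∀ n : ℕ, (C * M ^ (n + 1) : ℝ) * Real.exp (s - s * ((n : ℝ) - 1) ^ 2)
      ≤ K * Real.exp (-n) := by
    intro n
    have h₁ : (M : ℝ) ^ (n + 1) ≤ Real.exp ((n + 1) * M) := by
      have : (M : ℝ) ≤ Real.exp M := by linarith [Real.add_one_le_exp (M : ℝ)]
      calc (M : ℝ) ^ (n + 1) ≤ Real.exp M ^ (n + 1) := by gcongr
        _ = Real.exp ((n + 1) * M) := by rw [← Real.exp_nat_mul]; push_cast; rfl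
    have h₂ : (n + 1) * M + (s - s * ((n : ℝ) - 1) ^ 2)
        ≤ s + 2 * M + 1 + (M + 1) ^ 2 / (4 * s) + -n := by
      have h₃ : (M + 1) ^ 2 / (4 * s) - (M + 1) * ((n : ℝ) - 1) + s * ((n : ℝ) - 1) ^ 2
          = s * (((n : ℝ) - 1) - (M + 1) / (2 * s)) ^ 2 := by
        field_simp
        ring
      have h₄ : 0 ≤ s * (((n : ℝ) - 1) - (M + 1) / (2 * s)) ^ 2 := by positivity
      rw [← h₃] at h₄
      linarith
    calc (C * M ^ (n + 1) : ℝ) * Real.exp (s - s * ((n : ℝ) - 1) ^ 2)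
        ≤ (C * Real.exp ((n + 1) * M)) * Real.exp (s - s * ((n : ℝ) - 1) ^ 2) := by gcongr
      _ = C * Real.exp ((n + 1) * M + (s - s * ((n : ℝ) - 1) ^ 2)) := by
        rw [mul_assoc, ← Real.exp_add]
      _ ≤ C * Real.exp (s + 2 * M + 1 + (M + 1) ^ 2 / (4 * s) + -n) := by gcongr
      _ = K * Real.exp (-n) := by rw [Real.exp_add, hK, mul_assoc]
  have hu : Summable fun n : ℕ => K * Real.exp (-n) := Real.summable_exp_neg_nat.mul_left K
  refine summable_of_sum_le (c := ∑' n : ℕ, K * Real.exp (-n))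
    (fun x => indicator_nonneg (fun _ _ => (Real.exp_pos _).le) _) fun F => ?_
  set G : Finset (S.heteroclinic P Q) :=
    F.filter fun x : S.heteroclinic P Q => (x : X) ∈ S.leafCover t with hG
  have e₁ : ∑ x ∈ F, (S.leafCover t).indicator
      (fun x => Real.exp (-s * (1 + S.omegaS ω₀ x ^ 2))) (x : X)
      = ∑ x ∈ G, Real.exp (-s * (1 + S.omegaS ω₀ x ^ 2)) := by
    rw [hG, Finset.sum_filter]
    rfl
  set d : S.heteroclinic P Q → ℕ := fun x => (S.entryTime P ε x).toNat with hd
  rw [e₁, ← Finset.sum_fiberwise_of_maps_to (g := d) (t := G.image d)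
    fun x hx => Finset.mem_image_of_mem _ hx]
  have hKpos : 0 ≤ K := by positivity
  refine (Finset.sum_le_sum fun n _ => ?_).trans
    (hu.sum_le_tsum (G.image d) fun n _ => mul_nonneg hKpos (Real.exp_pos _).le)
  have hterm : ∀ x ∈ G.filter (fun x => d x = n), Real.exp (-s * (1 + S.omegaS ω₀ x ^ 2)) ≤
      Real.exp (s - s * ((n : ℝ) - 1) ^ 2) := by
    intro x hx
    have hxn : (S.entryTime P ε x).toNat = n := (Finset.mem_filter.1 hx).2
    have hω := (h.omegaS_mem_Icc h0 (by linarith) hω₀ x.2).1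
    refine Real.exp_le_exp.2 ?_
    rcases Nat.eq_zero_or_pos n with rfl | hn
    · have : 0 ≤ s * (1 + S.omegaS ω₀ (x : X) ^ 2) := by positivity
      push_cast
      linarith
    · have e : S.entryTime P ε (x : X) = n := by omega
      rw [e] at hω
      push_cast at hω
      have hn1 : (0 : ℝ) ≤ (n : ℝ) - 1 := by
        have : (1 : ℝ) ≤ n := by exact_mod_cast hn
        linarith
      have := mul_le_mul_of_nonneg_left (pow_le_pow_left₀ hn1 hω 2) hs.le
      linarith
  have hcard : (G.filter fun x => d x = n).card ≤ C * M ^ (n + 1) := by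
    rw [← Finset.card_image_of_injective _ Subtype.val_injective]
    refine H n _ fun y hy => ?_
    obtain ⟨x, hx, rfl⟩ := Finset.mem_image.1 hy
    obtain ⟨hx₁, hx₂⟩ := Finset.mem_filter.1 hx
    refine ⟨x.2, (Finset.mem_filter.1 hx₁).2, ?_⟩
    rw [← hx₂]
    exact Int.self_le_toNat _
  refine (Finset.sum_le_card_nsmul _ _ _ hterm).trans (le_trans ?_ (hgauss n))
  rw [nsmul_eq_mul]
  gcongr
  exact_mod_cast hcard

end EntryTime

end SmaleSpace

namespace SmaleSpace

section Groupoid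

variable {X : Type*} [MetricSpace X] [CompactSpace X] {S : SmaleSpace X} {P Q : Set X}

/-! ### The étale groupoid -/

lemma isOpen_basicSet {v w : X} {N : ℕ} {δ : ℝ} (h : S.IsAdmissible Q v w N δ) :
    IsOpen (S.basicSet Q v w N δ) :=
  TopologicalSpace.isOpen_generateFrom_of_mem ⟨v, w, N, δ, h, rfl⟩

lemma exists_mapsTo_iterate_localUnstable (S : SmaleSpace X) (v : X) (N : ℕ) {r : ℝ}
    (hr : 0 < r) : ∃ δ₀ > 0, ∀ δ ≤ δ₀, ∀ n ≤ N,
      MapsTo S.φ^[n] (S.localUnstable v δ) (S.localUnstable (S.φ^[n] v) r) := by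
  have hev : ∀ᶠ y in 𝓝 v, ∀ n ∈ Finset.range (N + 1),
      dist (S.φ^[n] v) (S.φ^[n] y) < min r S.eps := by
    rw [Finset.eventually_all]
    intro n _
    have hc : Continuous fun y => dist (S.φ^[n] v) (S.φ^[n] y) :=
      continuous_const.dist (S.φ.continuous.iterate n)
    refine hc.continuousAt.eventually_lt continuousAt_const ?_
    simpa using ⟨hr, S.eps_pos⟩
  obtain ⟨δ₀, hδ₀, H⟩ := Metric.eventually_nhds_iff.1 hev
  refine ⟨δ₀, hδ₀, fun δ hδ n hn y hy => ?_⟩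
  have hd : ∀ k ≤ N, dist (S.φ^[k] v) (S.φ^[k] y) < min r S.eps := fun k hk =>
    H (by rw [dist_comm]; exact hy.1.trans_le hδ) k (Finset.mem_range.2 (Nat.lt_succ_of_le hk))
  exact iterate_mem_localUnstable hy (fun k hk => (hd k (hk.trans hn)).trans_le (min_le_right _ _))
    ((hd n hn).trans_le (min_le_left _ _))

/-- The basic sets `V^s(v, w, h^s, δ)` with small `δ` exist at each `(v, w) ∈ G`. -/
lemma exists_isAdmissible (g : S.StableGroupoid Q) {r : ℝ} (hr : 0 < r) :
    ∃ N δ, S.IsAdmissible Q g.1.1 g.1.2 N δ ∧ δ ≤ r := by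
  have he := half_pos S.eps_pos
  obtain ⟨⟨v, w⟩, hvw, hv, hw⟩ := g
  obtain ⟨N, hN⟩ := (hvw.eventually_mem_localStable he).exists
  obtain ⟨δ₁, hδ₁, H₁⟩ := S.exists_mapsTo_iterate_localUnstable v N he
  obtain ⟨δ₂, hδ₂, H₂⟩ := S.exists_mapsTo_iterate_localUnstable w N he
  refine ⟨N, min (min δ₁ δ₂) (min r (S.eps / 4)), ⟨hvw, hv, hw, hN, ?_, ?_, ?_, ?_⟩, ?_⟩
  · have := S.eps_pos
    positivity
  · have := min_le_right (min δ₁ δ₂) (min r (S.eps / 4))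
    have := min_le_right r (S.eps / 4)
    linarith
  · exact H₁ _ ((min_le_left _ _).trans (min_le_left _ _))
  · exact H₂ _ ((min_le_left _ _).trans (min_le_right _ _))
  · exact (min_le_right _ _).trans (min_le_left _ _)

lemma symm_iterate_iterate (S : SmaleSpace X) (n : ℕ) (x : X) : S.φ.symm^[n] (S.φ^[n] x) = x :=
  Function.LeftInverse.iterate (fun y => S.φ.symm_apply_apply y) n x

lemma mem_basicSet_self (g : S.StableGroupoid Q) {N : ℕ} {δ : ℝ}
    (h : S.IsAdmissible Q g.1.1 g.1.2 N δ) : g ∈ S.basicSet Q g.1.1 g.1.2 N δ := by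
  obtain ⟨-, -, -, hN, hδ, -, -, -⟩ := h
  have he := S.eps_pos
  refine ⟨self_mem_localUnstable hδ, ?_, self_mem_localUnstable hδ, ?_⟩
  · rw [holonomy, hN.2, symm_iterate_iterate]
  · exact (mem_localStable_comm le_rfl).1 (localStable_mono (by linarith) hN)

/-- The source map is injective on basic sets, since `h^s` is a function. -/
lemma eq_of_mem_basicSet_of_snd_eq {v w : X} {N : ℕ} {δ : ℝ} {g g' : S.StableGroupoid Q}
    (hg : g ∈ S.basicSet Q v w N δ) (hg' : g' ∈ S.basicSet Q v w N δ) (h : g.1.2 = g'.1.2) :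
    g = g' := by
  refine Subtype.ext (Prod.ext ?_ h)
  rw [hg.2.1, hg'.2.1, h]

/-- The range map is injective on basic sets: `φ^N(x)` is the bracket of `φ^N(h^s(x))` with
`φ^N(w)`, so that `x` is recovered from `h^s(x)`. -/
lemma eq_of_mem_basicSet_of_fst_eq {v w : X} {N : ℕ} {δ : ℝ} (h : S.IsAdmissible Q v w N δ)
    {g g' : S.StableGroupoid Q}
    (hg : g ∈ S.basicSet Q v w N δ) (hg' : g' ∈ S.basicSet Q v w N δ) (hgg : g.1.1 = g'.1.1) :
    g = g' := by
  have he := S.eps_pos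
  obtain ⟨-, -, -, hN, -, -, hv, hw⟩ := h
  have key : ∀ g ∈ S.basicSet Q v w N δ,
      S.bracket (S.φ^[N] g.1.1) (S.φ^[N] w) = S.φ^[N] g.1.2 := by
    rintro g ⟨h₁, -, h₃, h₄⟩
    have hwy := hw N le_rfl h₁
    have hvx := hv N le_rfl h₃
    have hd : dist (S.φ^[N] g.1.1) (S.φ^[N] w) < S.eps := by
      have := dist_triangle_left (S.φ^[N] g.1.1) (S.φ^[N] w) (S.φ^[N] v)
      linarith [hvx.1, hN.1]
    have hxy : dist (S.φ^[N] g.1.1) (S.φ^[N] g.1.2) < S.eps := by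
      rw [dist_comm]
      exact h₄.1
    have := S.bracket_right (S.φ^[N] g.1.1) (S.φ^[N] w) (S.φ^[N] g.1.2)
      (by linarith [hwy.1]) (by rw [hwy.2]; exact hd) hxy
    rw [hwy.2] at this
    rw [this, h₄.2]
  refine Subtype.ext (Prod.ext hgg (S.φ.injective.iterate N ?_))
  rw [← key g hg, ← key g' hg', hgg]

/-- If `x` and `y` have come together along a stable leaf at time `N`, then `y` enters
`X^s(P, ε)` not much later than `x`. -/
lemma IsPeriodicPair.exists_entryTime_le_add (h : S.IsPeriodicPair P Q) {ε : ℝ} (h0 : 0 < ε)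
    (hε : ε ≤ S.eps / 2) (N L : ℕ) :
    ∃ K : ℕ, ∀ x ∈ S.heteroclinic P Q, ∀ y ∈ S.heteroclinic P Q,
      S.φ^[N] y ∈ S.localStable (S.φ^[N] x) S.eps → -(L : ℤ) ≤ S.entryTime P ε x →
      S.entryTime P ε y ≤ S.entryTime P ε x + K := by
  have he := S.eps_pos
  have hε' : ε ≤ S.eps := by linarith
  obtain ⟨m, hm⟩ :=
    ((tendsto_inv_lam_pow_mul (S := S) (ε + S.eps)).eventually_lt_const h0).exists
  refine ⟨N + L + m, fun x hx y hy hxy hL => ?_⟩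
  set τ := max (S.entryTime P ε x) N with hτ
  obtain ⟨k, hk⟩ : ∃ k : ℕ, τ = N + k := ⟨(τ - N).toNat, by omega⟩
  have hx₁ : (S.φ ^ τ) x ∈ S.localStableSet P ε :=
    (h.zpow_mem_localStableSet_iff h0 hε' hx τ).2 (le_max_left _ _)
  rw [hk, ← Nat.cast_add, add_comm, zpow_natCast_apply, Function.iterate_add_apply] at hx₁
  obtain ⟨p, hp, hxp⟩ := iterate_mem_localStableSet hε' h.mapsTo_left hx₁ m
  have hxy₁ := iterate_mem_localStable he.le le_rfl (iterate_mem_localStable' le_rfl hxy k) m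
  have hpow : S.lam⁻¹ ^ m ≤ 1 := pow_le_one₀ S.inv_lam_nonneg S.inv_lam_lt_one.le
  have hy₁ : S.φ^[m] (S.φ^[k] (S.φ^[N] y)) ∈ S.localStable p ε := by
    refine localStable_trans (localStable_mono ?_ hxp) (localStable_mono ?_ hxy₁) hε' ?_
    · exact (mul_le_of_le_one_left h0.le hpow).trans hε'
    · exact mul_le_of_le_one_left he.le hpow
    · have := dist_triangle p (S.φ^[m] (S.φ^[k] (S.φ^[N] x))) (S.φ^[m] (S.φ^[k] (S.φ^[N] y)))
      rw [mul_add] at hm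
      linarith [hxp.1, hxy₁.1]
  have hy₂ := (h.zpow_mem_localStableSet_iff h0 hε' hy ((m + (k + N) : ℕ) : ℤ)).1 (by
    rw [zpow_natCast_apply, Function.iterate_add_apply, Function.iterate_add_apply]
    exact mem_localStableSet.2 ⟨p, hp, hy₁⟩)
  push_cast at hy₂ ⊢
  omega

lemma IsPeriodicPair.exists_abs_entryTime_sub_le (h : S.IsPeriodicPair P Q) {ε : ℝ} (h0 : 0 < ε)
    (hε : ε ≤ S.eps / 2) {v w : X} {N : ℕ} {δ : ℝ} (hvw : S.IsAdmissible Q v w N δ) :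
    ∃ K : ℕ, ∀ g ∈ S.basicSet Q v w N δ, g.1.1 ∈ S.heteroclinic P Q →
      g.1.2 ∈ S.heteroclinic P Q →
      |S.entryTime P ε g.1.1 - S.entryTime P ε g.1.2| ≤ K := by
  classical
  obtain ⟨L, hL⟩ := h.exists_le_entryTime h0 hε {v, w}
  obtain ⟨K, hK⟩ := h.exists_entryTime_le_add h0 hε N L
  refine ⟨K, fun g hg h₁ h₂ => ?_⟩
  have hδ := hvw.2.2.2.2.2.1
  have hx := hL _ h₁ (mem_leafCover.2 ⟨v, by simp, localUnstable_mono hδ.le hg.2.2.1⟩)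
  have hy := hL _ h₂ (mem_leafCover.2 ⟨w, by simp, localUnstable_mono hδ.le hg.1⟩)
  have e₁ := hK _ h₂ _ h₁ hg.2.2.2 hy
  have e₂ := hK _ h₁ _ h₂ ((mem_localStable_comm le_rfl).1 hg.2.2.2) hx
  rw [abs_le]
  constructor <;> omega

lemma exists_finset_basicSet_cover (f : C_c(S.StableGroupoid Q, ℂ)) :
    ∃ T : Finset (Set (S.StableGroupoid Q)),
      (∀ V ∈ T, ∃ v w N δ, S.IsAdmissible Q v w N δ ∧ V = S.basicSet Q v w N δ) ∧
      ∀ g, f g ≠ 0 → ∃ V ∈ T, g ∈ V := by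
  classical
  have hex : ∀ g : S.StableGroupoid Q, ∃ V : Set (S.StableGroupoid Q), g ∈ V ∧
      ∃ v w N δ, S.IsAdmissible Q v w N δ ∧ V = S.basicSet Q v w N δ := fun g => by
    obtain ⟨N, δ, hadm, -⟩ := exists_isAdmissible g one_pos
    exact ⟨_, mem_basicSet_self g hadm, _, _, _, _, hadm, rfl⟩
  choose V hV hV' using hex
  obtain ⟨t, ht⟩ := f.hasCompactSupport.isCompact.elim_finite_subcover V
    (fun g => by
      obtain ⟨v, w, N, δ, hadm, e⟩ := hV' g
      rw [e]
      exact isOpen_basicSet hadm)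
    (fun g _ => mem_iUnion.2 ⟨g, hV g⟩)
  refine ⟨t.image V, fun U hU => ?_, fun g hg => ?_⟩
  · obtain ⟨g, -, rfl⟩ := Finset.mem_image.1 hU
    exact hV' g
  · obtain ⟨g', hg', hgg'⟩ := mem_iUnion₂.1 (ht (subset_closure hg))
    exact ⟨V g', Finset.mem_image_of_mem _ hg', hgg'⟩

lemma exists_leafCover_of_unitSpace (a : C_c(S.UnitSpace Q, ℂ)) :
    ∃ t : Finset X, ∀ x, a x ≠ 0 → x.1 ∈ S.leafCover t := by
  classical
  have he := half_pos S.eps_pos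
  obtain ⟨t, ht⟩ := a.hasCompactSupport.isCompact.elim_finite_subcover
    (fun x : S.UnitSpace Q => Subtype.val ⁻¹' S.localUnstable x.1 (S.eps / 2))
    (fun x => by
      refine @isOpen_induced _ _ S.unstableTopology _ _
        (TopologicalSpace.isOpen_generateFrom_of_mem ?_)
      exact ⟨x.1, S.eps / 2, he, by linarith, rfl⟩)
    (fun x _ => mem_iUnion.2 ⟨x, self_mem_localUnstable he⟩)
  refine ⟨t.image Subtype.val, fun x hx => ?_⟩
  obtain ⟨y, hy, hxy⟩ := mem_iUnion₂.1 (ht (subset_closure hx))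
  exact mem_leafCover.2 ⟨y.1, Finset.mem_image_of_mem _ hy, hxy⟩

/-! ### Bump functions on the unit space -/

open Classical in
variable (S Q) in
/-- The function `δ - d(x, ·)` on the units in `X^u(x, δ)`, extended by `0` to the groupoid. -/
noncomputable def leafCone (x : X) (δ : ℝ) (g : S.StableGroupoid Q) : ℝ :=
  if g.1.1 = g.1.2 ∧ g.1.2 ∈ S.localUnstable x δ then δ - dist x g.1.2 else 0

open Classical in
lemma leafCone_of_unit {x : X} {δ : ℝ} {g : S.StableGroupoid Q} (hg : g.1.1 = g.1.2) :
    S.leafCone Q x δ g = if g.1.2 ∈ S.localUnstable x δ then δ - dist x g.1.2 else 0 := by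
  unfold leafCone
  by_cases h : g.1.2 ∈ S.localUnstable x δ
  · rw [if_pos ⟨hg, h⟩, if_pos h]
  · rw [if_neg fun h' => h h'.2, if_neg h]

lemma continuous_leafCone (x : X) {δ : ℝ} (hδ : δ ≤ S.eps / 2) :
    Continuous (S.leafCone Q x δ) := by
  have he := S.eps_pos
  rw [continuous_iff_continuousAt]
  intro g
  rw [Metric.continuousAt_iff']
  intro r hr
  by_cases hg : g.1.1 = g.1.2
  · -- Along a leaf the function is `1`-Lipschitz.
    have key : ∀ y z : X, z ∈ S.localUnstable y (S.eps / 2) → y ∉ S.localUnstable x δ →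
        z ∈ S.localUnstable x δ → |δ - dist x z| ≤ dist z y := by
      intro y z hz hy hxz
      have hxy : δ ≤ dist x y := by
        by_contra hlt
        refine hy (localUnstable_trans (localUnstable_mono (by linarith) hxz)
          ((mem_localUnstable_comm le_rfl).1 (localUnstable_mono (by linarith) hz))
          (by linarith) (not_le.1 hlt))
      have := dist_triangle x z y
      rw [abs_of_nonneg (by linarith [hxz.1])]
      linarith
    obtain ⟨N, δ', hadm, hδ'⟩ := exists_isAdmissible g hr
    have hadm0 : S.IsAdmissible Q g.1.1 g.1.2 0 δ' := by
      obtain ⟨h₁, h₂, h₃, -, h₅, h₆, h₇, h₈⟩ := hadm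
      refine ⟨h₁, h₂, h₃, ?_, h₅, h₆, fun n hn => h₇ n (by omega), fun n hn => h₈ n (by omega)⟩
      rw [hg]
      exact self_mem_localStable (by linarith)
    filter_upwards [(isOpen_basicSet hadm0).mem_nhds (mem_basicSet_self g hadm0)] with g' hg'
    obtain ⟨h₁, h₂, -, -⟩ := hg'
    have hu : g'.1.1 = g'.1.2 := by
      rw [h₂, hg]
      exact ((mem_localUnstable_comm (by linarith [hadm.2.2.2.2.2.1])).1 h₁).2
    have hz : g'.1.2 ∈ S.localUnstable g.1.2 (S.eps / 2) :=
      localUnstable_mono hadm.2.2.2.2.2.1.le h₁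
    have hd : dist g'.1.2 g.1.2 < r := by
      rw [dist_comm]
      exact h₁.1.trans_le hδ'
    refine lt_of_le_of_lt ?_ hd
    rw [Real.dist_eq]
    rw [leafCone_of_unit hg, leafCone_of_unit hu]
    split_ifs with hA hB hB
    · have := abs_dist_sub_le g.1.2 g'.1.2 x
      rw [dist_comm g.1.2 x, dist_comm g'.1.2 x, dist_comm g.1.2 g'.1.2] at this
      rwa [sub_sub_sub_cancel_left]
    · rw [sub_zero]
      exact key _ _ hz hB hA
    · rw [zero_sub, abs_neg, dist_comm g'.1.2]
      exact key _ _ ((mem_localUnstable_comm (by linarith)).1 hz) hA hB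
    · simp
  · have hpos : 0 < dist g.1.1 g.1.2 := dist_pos.2 hg
    obtain ⟨N, δ', hadm, hδ'⟩ := exists_isAdmissible g (half_pos hpos)
    filter_upwards [(isOpen_basicSet hadm).mem_nhds (mem_basicSet_self g hadm)] with g' hg'
    have hu : g'.1.1 ≠ g'.1.2 := by
      intro e
      have h₁ := hg'.1.1
      have h₂ := hg'.2.2.1.1
      rw [e] at h₂
      have := dist_triangle_right g.1.1 g.1.2 g'.1.2
      linarith
    simpa [leafCone, hg, hu] using hr

lemma isCompact_setOf_leafCone_ge {x : X} (hx : x ∈ S.unstableSet Q) {δ : ℝ}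
    (hδ : 0 < δ) (hδ' : δ ≤ S.eps / 2) :
    IsCompact {g : S.StableGroupoid Q | δ / 2 ≤ S.leafCone Q x δ g} := by
  have he := S.eps_pos
  set K : Set X := Metric.closedBall x (δ / 2) ∩ (fun y => S.bracket x y) ⁻¹' {x} with hK
  have hKu : ∀ y ∈ K, y ∈ S.localUnstable x (S.eps / 2) := fun y hy =>
    ⟨by rw [dist_comm]; exact lt_of_le_of_lt hy.1 (by linarith), hy.2⟩
  have hKQ : ∀ y ∈ K, y ∈ S.unstableSet Q := fun y hy => by
    obtain ⟨q, hq, hqx⟩ := hx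
    exact ⟨q, hq, hqx.trans
      (unstableEquiv_of_mem_localUnstable (localUnstable_mono (by linarith) (hKu y hy)))⟩
  have hKc : IsClosed K := by
    refine ContinuousOn.preimage_isClosed_of_isClosed ?_ Metric.isClosed_closedBall
      isClosed_singleton
    refine S.continuousOn_bracket.comp (f := fun y => (x, y)) (by fun_prop) fun y hy => ?_
    change dist x y < S.eps
    rw [dist_comm]
    exact lt_of_le_of_lt hy (by linarith)
  have : CompactSpace K := isCompact_iff_compactSpace.1 hKc.isCompact
  let u : K → S.StableGroupoid Q := fun y =>
    ⟨(y.1, y.1), StableEquiv.refl _, hKQ y.1 y.2, hKQ y.1 y.2⟩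
  have hu : Continuous u := by
    refine continuous_generateFrom_iff.2 ?_
    rintro _ ⟨v, w, N, δ₁, hadm, rfl⟩
    obtain ⟨-, -, -, -, h₅, h₆, h₇, -⟩ := hadm
    refine isOpen_iff_mem_nhds.2 fun y hy => ?_
    obtain ⟨hyw, -, hyv, -⟩ := hy
    have hopen : ∀ z : X, dist z y.1 < δ₁ → ∀ᶠ y' : K in 𝓝 y, dist z y'.1 < δ₁ := fun z hz =>
      (continuous_const.dist continuous_subtype_val).continuousAt.eventually_lt
        continuousAt_const hz
    have hleaf : ∀ y' : K, y'.1 ∈ S.localUnstable y.1 S.eps := fun y' => by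
      have h₁ := hKu y.1 y.2
      have h₂ := hKu y'.1 y'.2
      refine localUnstable_trans ((mem_localUnstable_comm le_rfl).1
        (localUnstable_mono (by linarith) h₁)) (localUnstable_mono (by linarith) h₂) le_rfl ?_
      have := dist_triangle_left y.1 y'.1 x
      linarith [h₁.1, h₂.1]
    have hmem : ∀ (z : X) (y' : K), y.1 ∈ S.localUnstable z δ₁ → dist z y'.1 < δ₁ →
        y'.1 ∈ S.localUnstable z δ₁ := fun z y' hz hd =>
      localUnstable_trans (localUnstable_mono (by linarith) hz) (hleaf y') (by linarith) hd
    filter_upwards [hopen w hyw.1, hopen v hyv.1] with y' hw' hv'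
    have hv₁ := hmem v y' hyv hv'
    refine ⟨hmem w y' hyw hw', ?_, hv₁, self_mem_localStable he⟩
    have := ((mem_localUnstable_comm (by linarith)).1 (h₇ N le_rfl hv₁)).2
    change y'.1 = S.holonomy v N y'.1
    rw [holonomy, this, symm_iterate_iterate]
  refine (isCompact_range hu).of_isClosed_subset
    (isClosed_le continuous_const (continuous_leafCone x hδ')) fun g hg => ?_
  have hg' : δ / 2 ≤ S.leafCone Q x δ g := hg
  unfold leafCone at hg'
  split_ifs at hg' with hc
  · refine ⟨⟨g.1.2, ?_, hc.2.2⟩, Subtype.ext (Prod.ext hc.1.symm rfl)⟩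
    rw [Metric.mem_closedBall, dist_comm]
    linarith
  · linarith

/-- For each unit there is a function in `C_c(G)` that is supported on units and takes the value
`1` at the given unit. -/
lemma exists_compactlySupported_unit {x : X} (hx : x ∈ S.unstableSet Q) :
    ∃ f : C_c(S.StableGroupoid Q, ℂ), (∀ g, f g ≠ 0 → g.1.1 = g.1.2) ∧
      ∀ g : S.StableGroupoid Q, g.1 = (x, x) → f g = 1 := by
  have he := S.eps_pos
  set δ := S.eps / 2 with hδ
  have hδ0 : 0 < δ := by linarith
  let F : S.StableGroupoid Q → ℂ := fun g =>
    ((max (S.leafCone Q x δ g - δ / 2) 0 / (δ / 2) : ℝ) : ℂ)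
  have hF : Continuous F := by
    have := continuous_leafCone (Q := Q) x hδ.le
    fun_prop
  have hne : ∀ g, F g ≠ 0 → δ / 2 ≤ S.leafCone Q x δ g := fun g hg => by
    by_contra hlt
    refine hg ?_
    simp only [F]
    rw [max_eq_right (by linarith)]
    simp
  have hc : HasCompactSupport F :=
    HasCompactSupport.intro' (isCompact_setOf_leafCone_ge hx hδ0 hδ.le)
      (isClosed_le continuous_const (continuous_leafCone x hδ.le)) fun g hg => by
        by_contra h
        exact hg (hne g h)
  refine ⟨⟨⟨F, hF⟩, hc⟩, fun g hg => ?_, fun g hg => ?_⟩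
  · have := hne g hg
    unfold leafCone at this
    split_ifs at this with h
    · exact h.1
    · linarith
  · change F g = 1
    have hcone : S.leafCone Q x δ g = δ := by
      simp [leafCone, hg, self_mem_localUnstable hδ0]
    simp only [F]
    rw [hcone, max_eq_left (by linarith), sub_half, div_self (by linarith)]
    simp

end Groupoid

end SmaleSpace

section SequenceSpace

open Classical

variable {ι : Type*}

/-! ### Operators on `ℓ²` given by kernels -/

local notation "ℓ²" => lp (fun _ : ι => ℂ) 2

/-- The standard basis vector `δ_x` of `ℓ²(ι)`. -/
noncomputable def deltaVec (x : ι) : ℓ² := lp.single 2 x (1 : ℂ)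

lemma deltaVec_apply (x y : ι) : deltaVec x y = if y = x then 1 else 0 := by
  rw [deltaVec, lp.single_apply, Pi.single_apply]

lemma norm_deltaVec (x : ι) : ‖deltaVec x‖ = 1 := by
  rw [deltaVec, lp.norm_single (by norm_num)]
  simp

lemma deltaVec_ne_zero (x : ι) : deltaVec x ≠ 0 := by
  intro h
  have := norm_deltaVec x
  rw [h, norm_zero] at this
  exact zero_ne_one this

lemma inner_deltaVec_left (x : ι) (ξ : ℓ²) : inner ℂ (deltaVec x) ξ = ξ x := by
  rw [deltaVec, lp.inner_single_left]
  simp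

lemma hasSum_smul_deltaVec (ξ : ℓ²) : HasSum (fun x => ξ x • deltaVec x) ξ := by
  have h := lp.hasSum_single (p := 2) (by norm_num) ξ
  have e : (fun x => ξ x • deltaVec x) = fun x => lp.single 2 x (ξ x) := by
    funext x
    rw [deltaVec, ← lp.single_smul, smul_eq_mul, mul_one]
  rw [e]
  exact h

lemma ContinuousLinearMap.ext_deltaVec {T T' : ℓ² →L[ℂ] ℓ²}
    (h : ∀ x, T (deltaVec x) = T' (deltaVec x)) : T = T' := by
  ext1 ξ
  have h₁ := T.hasSum (hasSum_smul_deltaVec ξ)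
  have h₂ := T'.hasSum (hasSum_smul_deltaVec ξ)
  simp only [map_smul, h] at h₁ h₂
  exact h₁.unique h₂

lemma lp.sum_norm_sq_le (ξ : ℓ²) (F : Finset ι) : ∑ x ∈ F, ‖ξ x‖ ^ 2 ≤ ‖ξ‖ ^ 2 := by
  have := lp.sum_rpow_le_norm_rpow (p := 2) (by norm_num) ξ F
  norm_num at this
  exact this

/-- Schur's test, for a kernel with boundedly many nonzero entries in each row and column: by the
Cauchy-Schwarz inequality in the rows, and by counting the columns. -/
lemma sum_norm_sq_kernel_le {k : ι → ι → ℂ} {r c : ι → Finset ι} {C : ℝ} {M : ℕ}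
    (hC : ∀ x y, ‖k x y‖ ≤ C) (hrc : ∀ x y, k x y ≠ 0 → x ∈ c y)
    (hr : ∀ x, (r x).card ≤ M) (hc : ∀ y, (c y).card ≤ M) (ξ : ℓ²) (F : Finset ι) :
    ∑ x ∈ F, ‖∑ y ∈ r x, k x y * ξ y‖ ^ 2 ≤ (C * M * ‖ξ‖) ^ 2 := by
  have hrow : ∀ x, ‖∑ y ∈ r x, k x y * ξ y‖ ^ 2
      ≤ (M * C ^ 2) * ∑ y ∈ r x, if x ∈ c y then ‖ξ y‖ ^ 2 else 0 := by
    intro x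
    have h₁ : ‖∑ y ∈ r x, k x y * ξ y‖ ≤ ∑ y ∈ r x, ‖k x y * ξ y‖ := norm_sum_le _ _
    calc ‖∑ y ∈ r x, k x y * ξ y‖ ^ 2 ≤ (∑ y ∈ r x, ‖k x y * ξ y‖) ^ 2 := by gcongr
      _ ≤ (r x).card * ∑ y ∈ r x, ‖k x y * ξ y‖ ^ 2 := sq_sum_le_card_mul_sum_sq
      _ ≤ M * ∑ y ∈ r x, C ^ 2 * (if x ∈ c y then ‖ξ y‖ ^ 2 else 0) := by
        gcongr with y hy
        · exact_mod_cast hr x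
        · split_ifs with h
          · rw [norm_mul, mul_pow]
            gcongr
            exact hC x y
          · have : k x y = 0 := by
              by_contra h'
              exact h (hrc x y h')
            simp [this]
      _ = _ := by rw [← Finset.mul_sum, mul_assoc]
  have hcol : ∑ x ∈ F, ∑ y ∈ r x, (if x ∈ c y then ‖ξ y‖ ^ 2 else 0) ≤ M * ‖ξ‖ ^ 2 := by
    set U := F.biUnion r
    calc ∑ x ∈ F, ∑ y ∈ r x, (if x ∈ c y then ‖ξ y‖ ^ 2 else 0)
        ≤ ∑ x ∈ F, ∑ y ∈ U, (if x ∈ c y then ‖ξ y‖ ^ 2 else 0) := by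
          refine Finset.sum_le_sum fun x hx => Finset.sum_le_sum_of_subset_of_nonneg
            (Finset.subset_biUnion_of_mem r hx) fun y _ _ => ?_
          positivity
      _ = ∑ y ∈ U, ((F.filter fun x => x ∈ c y).card : ℝ) * ‖ξ y‖ ^ 2 := by
          rw [Finset.sum_comm]
          refine Finset.sum_congr rfl fun y _ => ?_
          rw [← Finset.sum_filter, Finset.sum_const, nsmul_eq_mul]
      _ ≤ ∑ y ∈ U, (M : ℝ) * ‖ξ y‖ ^ 2 := by
          gcongr with y hy
          refine (Finset.card_le_card (t := c y) fun x hx => ?_).trans (hc y)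
          exact (Finset.mem_filter.1 hx).2
      _ ≤ M * ‖ξ‖ ^ 2 := by
          rw [← Finset.mul_sum]
          gcongr
          exact lp.sum_norm_sq_le ξ U
  calc ∑ x ∈ F, ‖∑ y ∈ r x, k x y * ξ y‖ ^ 2
      ≤ ∑ x ∈ F, (M * C ^ 2) * ∑ y ∈ r x, (if x ∈ c y then ‖ξ y‖ ^ 2 else 0) :=
        Finset.sum_le_sum fun x _ => hrow x
    _ ≤ (M * C ^ 2) * (M * ‖ξ‖ ^ 2) := by
        rw [← Finset.mul_sum]
        gcongr
    _ = (C * M * ‖ξ‖) ^ 2 := by ring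

/-- A bounded kernel with at most `M` nonzero entries in each row and each column defines a
bounded operator. -/
lemma exists_clm_of_kernel {k : ι → ι → ℂ} {r c : ι → Finset ι} {C : ℝ} {M : ℕ} (hC0 : 0 ≤ C)
    (hC : ∀ x y, ‖k x y‖ ≤ C) (hrc : ∀ x y, k x y ≠ 0 → x ∈ c y)
    (hr : ∀ x, (r x).card ≤ M) (hc : ∀ y, (c y).card ≤ M) :
    ∃ T : ℓ² →L[ℂ] ℓ², (∀ ξ x, T ξ x = ∑ y ∈ r x, k x y * ξ y) ∧ ‖T‖ ≤ C * M := by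
  have hmem : ∀ ξ : ℓ², Memℓp (fun x => ∑ y ∈ r x, k x y * ξ y) 2 := fun ξ => by
    refine memℓp_gen' (C := (C * M * ‖ξ‖) ^ 2) fun F => ?_
    have := sum_norm_sq_kernel_le hC hrc hr hc ξ F
    norm_num
    exact this
  let L : ℓ² →ₗ[ℂ] ℓ² :=
    { toFun := fun ξ => ⟨fun x => ∑ y ∈ r x, k x y * ξ y, hmem ξ⟩
      map_add' := fun ξ η => by
        ext x
        change ∑ y ∈ r x, k x y * (ξ + η) y = (∑ y ∈ r x, k x y * ξ y) + ∑ y ∈ r x, k x y * η y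
        rw [← Finset.sum_add_distrib]
        refine Finset.sum_congr rfl fun y _ => ?_
        rw [lp.coeFn_add, Pi.add_apply, mul_add]
      map_smul' := fun a ξ => by
        ext x
        change ∑ y ∈ r x, k x y * (a • ξ) y = a * ∑ y ∈ r x, k x y * ξ y
        rw [Finset.mul_sum]
        refine Finset.sum_congr rfl fun y _ => ?_
        rw [lp.coeFn_smul, Pi.smul_apply, smul_eq_mul, mul_left_comm] }
  have hL : ∀ ξ, ‖L ξ‖ ≤ C * M * ‖ξ‖ := fun ξ => by
    have h0 : 0 ≤ C * M * ‖ξ‖ := by positivity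
    refine lp.norm_le_of_forall_sum_le (p := 2) (by norm_num) h0 fun F => ?_
    have := sum_norm_sq_kernel_le hC hrc hr hc ξ F
    norm_num
    exact this
  exact ⟨L.mkContinuous (C * M) hL, fun ξ x => rfl,
    L.mkContinuous_norm_le (by positivity) hL⟩

/-- Bounded kernels whose rows and columns have a bounded number of nonzero entries. -/
def IsBandKernel (k : ι → ι → ℂ) : Prop :=
  ∃ (C : ℝ) (M : ℕ) (r c : ι → Finset ι), 0 ≤ C ∧ (∀ x y, ‖k x y‖ ≤ C) ∧
    (∀ x y, k x y ≠ 0 → y ∈ r x ∧ x ∈ c y) ∧ (∀ x, (r x).card ≤ M) ∧ ∀ y, (c y).card ≤ M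

/-- `T` is the operator with kernel `k`. -/
def HasKernel (T : ℓ² →L[ℂ] ℓ²) (k : ι → ι → ℂ) : Prop :=
  ∀ ξ x, T ξ x = ∑' y, k x y * ξ y

lemma IsBandKernel.exists_hasKernel {k : ι → ι → ℂ} (hk : IsBandKernel k) :
    ∃ T, HasKernel T k := by
  obtain ⟨C, M, r, c, hC0, hC, hrc, hr, hc⟩ := hk
  obtain ⟨T, hT, -⟩ := exists_clm_of_kernel hC0 hC (fun x y h => (hrc x y h).2) hr hc
  refine ⟨T, fun ξ x => ?_⟩
  rw [hT, tsum_eq_sum]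
  intro y hy
  have : k x y = 0 := by
    by_contra h
    exact hy (hrc x y h).1
  rw [this, zero_mul]

lemma IsBandKernel.summable {k : ι → ι → ℂ} (hk : IsBandKernel k) (x : ι) (f : ι → ℂ) :
    Summable fun y => k x y * f y := by
  obtain ⟨C, M, r, c, -, -, hrc, -, -⟩ := hk
  refine summable_of_ne_finset_zero (s := r x) fun y hy => ?_
  have : k x y = 0 := by
    by_contra h
    exact hy (hrc x y h).1
  rw [this, zero_mul]

lemma IsBandKernel.conjTranspose {k : ι → ι → ℂ} (hk : IsBandKernel k) :
    IsBandKernel fun x y => starRingEnd ℂ (k y x) := by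
  obtain ⟨C, M, r, c, hC0, hC, hrc, hr, hc⟩ := hk
  refine ⟨C, M, c, r, hC0, fun x y => ?_, fun x y h => ?_, hc, hr⟩
  · rw [RCLike.norm_conj]
    exact hC y x
  · exact (hrc y x fun h' => h (by simp only [h', map_zero])).symm

lemma HasKernel.apply_deltaVec {T : ℓ² →L[ℂ] ℓ²} {k : ι → ι → ℂ} (hT : HasKernel T k) (x y : ι) :
    T (deltaVec y) x = k x y := by
  rw [hT, tsum_eq_single y]
  · simp [deltaVec_apply]
  · intro z hz
    simp [deltaVec_apply, hz]

lemma HasKernel.conjTranspose {T : ℓ² →L[ℂ] ℓ²} {k : ι → ι → ℂ} (hT : HasKernel T k) :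
    HasKernel (star T) fun x y => starRingEnd ℂ (k y x) := by
  intro ξ x
  rw [← inner_deltaVec_left, ContinuousLinearMap.star_eq_adjoint,
    ContinuousLinearMap.adjoint_inner_right, lp.inner_eq_tsum]
  refine tsum_congr fun y => ?_
  rw [hT.apply_deltaVec, RCLike.inner_apply, mul_comm]

/-- If `ω(x) - ω(y)` is bounded on the support of the kernel of `T`, then `T` has a bounded
commutator with the diagonal operator of `ω`: it has the kernel `(ω(x) - ω(y)) k(x, y)`. -/
lemma HasKernel.hasBoundedCommutator {T : ℓ² →L[ℂ] ℓ²} {k : ι → ι → ℂ} (hT : HasKernel T k)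
    (hk : IsBandKernel k) {ω : ι → ℝ} {L : ℝ} (hL0 : 0 ≤ L)
    (hL : ∀ x y, k x y ≠ 0 → |ω x - ω y| ≤ L) : HasBoundedCommutator (diagonalOp ω) T := by
  have hk' : IsBandKernel fun x y => ((ω x - ω y : ℝ) : ℂ) * k x y := by
    obtain ⟨C, M, r, c, hC0, hC, hrc, hr, hc⟩ := hk
    refine ⟨L * C, M, r, c, by positivity, fun x y => ?_, fun x y h => hrc x y ?_, hr, hc⟩
    · by_cases h : k x y = 0
      · simp only [h, mul_zero, norm_zero]
        positivity
      · rw [norm_mul, Complex.norm_real, Real.norm_eq_abs]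
        exact mul_le_mul (hL x y h) (hC x y) (norm_nonneg _) hL0
    · exact right_ne_zero_of_mul h
  obtain ⟨B, hB⟩ := hk'.exists_hasKernel
  refine ⟨B, fun ξ => ?_⟩
  have key : ∀ x, (ω x : ℂ) * T ξ x = T (diagonalOp ω ξ) x + B ξ x := fun x => by
    have e : ∀ y, diagonalOp ω ξ y = (ω y : ℂ) * ξ.1 y := fun y => rfl
    rw [hT, hT, hB, ← tsum_mul_left, ← (hk.summable x _).tsum_add (hk'.summable x _)]
    refine tsum_congr fun y => ?_
    rw [e]
    push_cast
    ring
  have hmem : Memℓp (fun x => (ω x : ℂ) * T ξ x) 2 := by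
    have : (fun x => (ω x : ℂ) * T ξ x) = ⇑(T (diagonalOp ω ξ) + B ξ) := by
      funext x
      rw [key, lp.coeFn_add, Pi.add_apply]
    rw [this]
    exact lp.memℓp _
  refine ⟨hmem, ?_⟩
  ext x
  rw [lp.coeFn_sub, Pi.sub_apply]
  have e : diagonalOp ω ⟨T ξ, hmem⟩ x = (ω x : ℂ) * T ξ x := rfl
  rw [e, key, add_sub_cancel_left]

end SequenceSpace

section Commutators

/-! ### Bounded commutators -/

variable {H : Type*} [NormedAddCommGroup H] [InnerProductSpace ℂ H]
  {D : H →ₗ.[ℂ] H} {a b : H →L[ℂ] H}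

lemma HasBoundedCommutator.zero : HasBoundedCommutator D 0 := by
  refine ⟨0, fun ξ => ⟨D.domain.zero_mem, ?_⟩⟩
  have : D ⟨(0 : H →L[ℂ] H) ξ, D.domain.zero_mem⟩ = 0 := D.map_zero
  rw [this]
  simp

lemma HasBoundedCommutator.add (ha : HasBoundedCommutator D a) (hb : HasBoundedCommutator D b) :
    HasBoundedCommutator D (a + b) := by
  obtain ⟨A, hA⟩ := ha
  obtain ⟨B, hB⟩ := hb
  refine ⟨A + B, fun ξ => ?_⟩
  obtain ⟨h₁, e₁⟩ := hA ξ
  obtain ⟨h₂, e₂⟩ := hB ξ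
  refine ⟨D.domain.add_mem h₁ h₂, ?_⟩
  have : D ⟨(a + b) ξ, D.domain.add_mem h₁ h₂⟩ = D ⟨a ξ, h₁⟩ + D ⟨b ξ, h₂⟩ :=
    D.map_add ⟨a ξ, h₁⟩ ⟨b ξ, h₂⟩
  rw [this, add_apply, add_apply, ← e₁, ← e₂]
  abel

lemma HasBoundedCommutator.smul (c : ℂ) (ha : HasBoundedCommutator D a) :
    HasBoundedCommutator D (c • a) := by
  obtain ⟨A, hA⟩ := ha
  refine ⟨c • A, fun ξ => ?_⟩
  obtain ⟨h₁, e₁⟩ := hA ξ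
  refine ⟨D.domain.smul_mem c h₁, ?_⟩
  have : D ⟨(c • a) ξ, D.domain.smul_mem c h₁⟩ = c • D ⟨a ξ, h₁⟩ := D.map_smul c ⟨a ξ, h₁⟩
  rw [this, smul_apply, smul_apply, ← e₁, smul_sub]

lemma HasBoundedCommutator.mul (ha : HasBoundedCommutator D a) (hb : HasBoundedCommutator D b) :
    HasBoundedCommutator D (a * b) := by
  obtain ⟨A, hA⟩ := ha
  obtain ⟨B, hB⟩ := hb
  refine ⟨A * b + a * B, fun ξ => ?_⟩
  obtain ⟨h₂, e₂⟩ := hB ξ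
  obtain ⟨h₁, e₁⟩ := hA ⟨b ξ, h₂⟩
  refine ⟨h₁, ?_⟩
  change D ⟨a (b ξ), h₁⟩ - a (b (D ξ)) = A (b ξ) + a (B ξ)
  have e₁' : D ⟨a (b ξ), h₁⟩ - a (D ⟨b ξ, h₂⟩) = A (b ξ) := e₁
  rw [← e₂, ← e₁', map_sub]
  abel

end Commutators

universe u

section Diagonal

open Classical

variable {ι : Type*}

/-! ### Bounded diagonal operators -/

local notation "ℓ²" => lp (fun _ : ι => ℂ) 2

/-- `T` is the diagonal operator with entries `d`. -/
def IsDiag (T : ℓ² →L[ℂ] ℓ²) (d : ι → ℂ) : Prop :=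
  ∀ ξ x, T ξ x = d x * ξ x

lemma exists_isDiag {d : ι → ℂ} {C : ℝ} (hC0 : 0 ≤ C) (hC : ∀ x, ‖d x‖ ≤ C) :
    ∃ T, IsDiag T d ∧ ‖T‖ ≤ C := by
  obtain ⟨T, hT, hn⟩ := exists_clm_of_kernel (k := fun x y => if y = x then d x else 0)
    (r := fun x => {x}) (c := fun x => {x}) (M := 1) hC0
    (fun x y => by
      split_ifs
      · exact hC x
      · simpa using hC0)
    (fun x y h => by
      have : y = x := by
        by_contra h'
        exact h (if_neg h')
      simp [this]) (by simp) (by simp)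
  exact ⟨T, fun ξ x => by simp [hT], by simpa using hn⟩

lemma IsDiag.apply_deltaVec {T : ℓ² →L[ℂ] ℓ²} {d : ι → ℂ} (hT : IsDiag T d) (x : ι) :
    T (deltaVec x) = d x • deltaVec x := by
  ext y
  rw [hT, lp.coeFn_smul, Pi.smul_apply, smul_eq_mul, deltaVec_apply]
  split_ifs with h
  · rw [h]
  · simp

lemma IsDiag.norm_le {T : ℓ² →L[ℂ] ℓ²} {d : ι → ℂ} (hT : IsDiag T d) (x : ι) : ‖d x‖ ≤ ‖T‖ := by
  have := T.le_opNorm (deltaVec x)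
  rwa [hT.apply_deltaVec, norm_smul, norm_deltaVec, mul_one, mul_one] at this

lemma IsDiag.ext {T T' : ℓ² →L[ℂ] ℓ²} {d : ι → ℂ} (hT : IsDiag T d) (hT' : IsDiag T' d) :
    T = T' := by
  ext ξ x
  rw [hT, hT']

lemma isDiag_of_apply_deltaVec {T : ℓ² →L[ℂ] ℓ²} {d : ι → ℂ}
    (h : ∀ x, T (deltaVec x) = d x • deltaVec x) : IsDiag T d := by
  have hC : ∀ x, ‖d x‖ ≤ ‖T‖ := fun x => by
    have := T.le_opNorm (deltaVec x)
    rwa [h, norm_smul, norm_deltaVec, mul_one, mul_one] at this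
  obtain ⟨B, hB, -⟩ := exists_isDiag (norm_nonneg T) hC
  have : T = B := ContinuousLinearMap.ext_deltaVec fun x => by rw [h, hB.apply_deltaVec]
  rwa [this]

lemma IsDiag.mul {T T' : ℓ² →L[ℂ] ℓ²} {d d' : ι → ℂ} (hT : IsDiag T d) (hT' : IsDiag T' d') :
    IsDiag (T * T') fun x => d x * d' x := by
  intro ξ x
  change T (T' ξ) x = _
  rw [hT, hT', mul_assoc]

lemma IsDiag.conj {T : ℓ² →L[ℂ] ℓ²} {d : ι → ℂ} (hT : IsDiag T d) :
    IsDiag (star T) fun x => starRingEnd ℂ (d x) := by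
  intro ξ x
  rw [← inner_deltaVec_left, ContinuousLinearMap.star_eq_adjoint,
    ContinuousLinearMap.adjoint_inner_right, hT.apply_deltaVec, inner_smul_left,
    inner_deltaVec_left]

lemma IsDiag.exists_eq_star_mul_self {T : ℓ² →L[ℂ] ℓ²} {d : ι → ℝ}
    (hT : IsDiag T fun x => (d x : ℂ)) (hd : ∀ x, 0 ≤ d x) :
    ∃ B : ℓ² →L[ℂ] ℓ², T = star B * B := by
  obtain ⟨B, hB, -⟩ := exists_isDiag (d := fun x => ((√(d x) : ℝ) : ℂ)) (Real.sqrt_nonneg ‖T‖)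
    (fun x => by
      rw [Complex.norm_real, Real.norm_of_nonneg (Real.sqrt_nonneg _)]
      refine Real.sqrt_le_sqrt ?_
      have := hT.norm_le x
      rwa [Complex.norm_real, Real.norm_of_nonneg (hd x)] at this)
  refine ⟨B, hT.ext ?_⟩
  have h := hB.conj.mul hB
  convert h using 2 with x
  rw [Complex.conj_ofReal, ← Complex.ofReal_mul, Real.mul_self_sqrt (hd x)]

/-- A diagonal operator whose entries tend to `0` is compact, as a norm limit of diagonal
operators of finite rank. -/
lemma IsDiag.isCompactOperator {T : ℓ² →L[ℂ] ℓ²} {d : ι → ℂ} (hT : IsDiag T d)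
    (hd : Tendsto d cofinite (𝓝 0)) : IsCompactOperator T := by
  have hfin : ∀ F : Finset ι, ∃ K : ℓ² →L[ℂ] ℓ², IsCompactOperator K ∧
      K = ∑ x ∈ F, (innerSL ℂ (deltaVec x)).smulRight (d x • deltaVec x) := by
    refine fun F => ⟨_, ?_, rfl⟩
    refine (compactOperator (RingHom.id ℂ) ℓ² ℓ²).sum_mem
      (f := fun x => ((innerSL ℂ (deltaVec x)).smulRight (d x • deltaVec x) : ℓ² →L[ℂ] ℓ²))
      fun x _ => ?_
    -- An operator of rank one factors through `ℂ`.
    have h₁ : IsCompactOperator ((ContinuousLinearMap.id ℂ ℂ).smulRight (d x • deltaVec x)) :=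
      isCompactOperator_of_locallyCompactSpace_rng _
    exact h₁.comp_clm (innerSL ℂ (deltaVec x))
  refine (isClosed_setOfPred_isCompactOperator (σ₁₂ := RingHom.id ℂ) (M₁ := ℓ²)
    (M₂ := ℓ²)).closure_subset (Metric.mem_closure_iff.2 fun r hr => ?_)
  have hev := hd.eventually (Metric.ball_mem_nhds 0 (half_pos hr))
  set F : Finset ι := (Filter.eventually_cofinite.1 hev).toFinset with hF
  obtain ⟨K, hK, hKF⟩ := hfin F
  refine ⟨K, hK, ?_⟩
  obtain ⟨B, hB, hn⟩ := exists_isDiag (d := fun x => if x ∈ F then 0 else d x) (half_pos hr).le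
    (fun x => by
      split_ifs with h
      · simpa using (half_pos hr).le
      · rw [hF, Set.Finite.mem_toFinset] at h
        have h' : d x ∈ Metric.ball (0 : ℂ) (r / 2) := not_not.1 h
        exact (mem_ball_zero_iff.1 h').le)
  rw [dist_eq_norm]
  have e : T - K = B := by
    rw [hKF]
    refine ContinuousLinearMap.ext_deltaVec fun y => ?_
    rw [sub_apply, sum_apply, hT.apply_deltaVec,
      hB.apply_deltaVec]
    have : ∀ x, ((innerSL ℂ (deltaVec x)).smulRight (d x • deltaVec x) : ℓ² →L[ℂ] ℓ²) (deltaVec y)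
        = if y = x then d y • deltaVec y else 0 := fun x => by
      rw [ContinuousLinearMap.smulRight_apply, innerSL_apply_apply, inner_deltaVec_left,
        deltaVec_apply]
      by_cases h : x = y
      · simp [h]
      · simp [h, Ne.symm h]
    simp only [this, Finset.sum_ite_eq]
    split_ifs <;> simp
  rw [e]
  linarith

/-- The standard basis of `ℓ²(ι)`. -/
noncomputable def deltaBasis : HilbertBasis ι ℂ ℓ² :=
  HilbertBasis.ofRepr (LinearIsometryEquiv.refl ℂ _)

lemma deltaBasis_apply (x : ι) : (deltaBasis : HilbertBasis ι ℂ ℓ²) x = deltaVec x := by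
  rw [← HilbertBasis.repr_symm_single]
  rfl

end Diagonal

/-! ### Functional calculus on eigenvectors -/

/-- The functional calculus acts on an eigenvector through the value at the eigenvalue. -/
lemma cfc_apply_eigenvector {H : Type*} [NormedAddCommGroup H] [InnerProductSpace ℂ H]
    [CompleteSpace H] {R : H →L[ℂ] H} (hR : IsSelfAdjoint R) {g : ℝ → ℝ}
    (hg : ContinuousOn g (spectrum ℝ R)) {r : ℝ} {v : H} (hv : R v = (r : ℂ) • v) (hv0 : v ≠ 0) :
    cfc g R v = (g r : ℂ) • v := by
  have hr : r ∈ spectrum ℝ R := by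
    intro hunit
    obtain ⟨u, hu⟩ := hunit
    have h0 : (u : H →L[ℂ] H) v = 0 := by
      rw [hu, sub_apply, hv, Algebra.algebraMap_eq_smul_one]
      simp
    have : ((↑u⁻¹ : H →L[ℂ] H) * u) v = 0 := by
      change (↑u⁻¹ : H →L[ℂ] H) ((u : H →L[ℂ] H) v) = 0
      rw [h0, map_zero]
    rw [Units.inv_mul] at this
    exact hv0 this
  have hcompact : CompactSpace (spectrum ℝ R) := isCompact_iff_compactSpace.1
    (ContinuousFunctionalCalculus.isCompact_spectrum (p := IsSelfAdjoint) R)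
  have key : ∀ f : C(spectrum ℝ R, ℝ), cfcHom hR f v = (f ⟨r, hr⟩ : ℂ) • v := by
    intro f
    induction f using ContinuousMap.induction_on_of_compact with
    | const c =>
      have : ContinuousMap.const (spectrum ℝ R) c = algebraMap ℝ _ c := rfl
      rw [this, AlgHomClass.commutes, Algebra.algebraMap_eq_smul_one]
      simp
    | id => rw [cfcHom_id hR, hv]; rfl
    | star_id =>
      rw [map_star, cfcHom_id hR, hR.star_eq, hv]
      simp
    | add f g hf hg =>
      rw [map_add, add_apply, hf, hg, ← add_smul, ContinuousMap.add_apply]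
      push_cast
      rfl
    | mul f g hf hg =>
      rw [map_mul]
      change cfcHom hR f (cfcHom hR g v) = _
      rw [hg, map_smul, hf, smul_smul, ContinuousMap.mul_apply]
      push_cast
      rw [mul_comm]
    | frequently f hf =>
      have hclosed : IsClosed {f : C(spectrum ℝ R, ℝ) | cfcHom hR f v = (f ⟨r, hr⟩ : ℂ) • v} := by
        have h₁ : Continuous fun f : C(spectrum ℝ R, ℝ) => cfcHom hR f v :=
          (ContinuousLinearMap.apply ℂ H v).continuous.comp (cfcHom_continuous hR)
        have h₂ : Continuous fun f : C(spectrum ℝ R, ℝ) => (f ⟨r, hr⟩ : ℂ) • v :=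
          (Complex.continuous_ofReal.comp (continuous_eval_const _)).smul
            continuous_const
        exact isClosed_eq h₁ h₂
      exact hclosed.mem_of_frequently_of_tendsto hf tendsto_id
  rw [cfc_apply g R hR hg, key]
  rfl

lemma continuousOn_ite_exp {t : ℝ} (ht : 0 < t) :
    ContinuousOn (fun r : ℝ => if r = 0 then 0 else Real.exp (-t / r)) (Ici 0) := by
  intro r hr
  rcases eq_or_lt_of_le (show (0 : ℝ) ≤ r from hr) with rfl | hpos
  · rw [← Ioi_insert, continuousWithinAt_insert_self]
    have h₁ : Tendsto (fun r : ℝ => Real.exp (-t / r)) (𝓝[>] 0) (𝓝 0) := by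
      refine Real.tendsto_exp_atBot.comp ?_
      have := tendsto_inv_nhdsGT_zero (𝕜 := ℝ).const_mul_atTop_of_neg (neg_lt_zero.2 ht)
      exact this.congr fun r => (div_eq_mul_inv _ _).symm
    change Tendsto _ _ (𝓝 (if (0 : ℝ) = 0 then 0 else Real.exp (-t / 0)))
    rw [if_pos rfl]
    refine h₁.congr' ?_
    filter_upwards [self_mem_nhdsWithin] with r hr
    rw [if_neg (ne_of_gt hr)]
  · have h₁ : ContinuousAt (fun r : ℝ => Real.exp (-t / r)) r :=
      Real.continuous_exp.continuousAt.comp (continuousAt_const.div continuousAt_id hpos.ne')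
    refine (h₁.congr ?_).continuousWithinAt
    filter_upwards [isOpen_ne.mem_nhds hpos.ne'] with r hr
    rw [if_neg hr]

lemma heatOp_apply_eigenvector {H : Type*} [NormedAddCommGroup H] [InnerProductSpace ℂ H]
    [CompleteSpace H] {R B : H →L[ℂ] H} (hR : R = star B * B) {t : ℝ} (ht : 0 < t) {r : ℝ}
    (hr : r ≠ 0) {v : H} (hv : R v = (r : ℂ) • v) (hv0 : v ≠ 0) :
    heatOp R t v = (Real.exp (-t / r) : ℂ) • v := by
  have hR0 : 0 ≤ R := hR ▸ star_mul_self_nonneg B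
  have hg := (continuousOn_ite_exp ht).mono fun s (hs : s ∈ spectrum ℝ R) =>
    spectrum_nonneg_of_nonneg hR0 hs
  rw [heatOp, cfc_apply_eigenvector (IsSelfAdjoint.of_nonneg hR0) hg hv hv0, if_neg hr]

/-- `T` is trace class if `T* T = A²` for a positive `A` with summable diagonal, since then
`A = |T|`. -/
lemma isTraceClass_of_mul_self_eq {ι H : Type u} [NormedAddCommGroup H] [InnerProductSpace ℂ H]
    [CompleteSpace H] {T A B : H →L[ℂ] H} (hA : A * A = star T * T) (hB : A = star B * B)
    (b : HilbertBasis ι ℂ H) (hs : Summable fun i => (inner ℂ (b i) (A (b i))).re) :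
    IsTraceClass T := by
  have : CFC.abs T = A := CFC.sqrt_unique hA (hB ▸ star_mul_self_nonneg B)
  exact ⟨ι, b, by rwa [this]⟩

lemma IsDiag.isTraceClass {ι : Type*} {T : lp (fun _ : ι => ℂ) 2 →L[ℂ] lp (fun _ : ι => ℂ) 2}
    {d : ι → ℂ} (hT : IsDiag T d) (hd : Summable fun x => ‖d x‖) : IsTraceClass T := by
  obtain ⟨A, hA, -⟩ := exists_isDiag (d := fun x => ((‖d x‖ : ℝ) : ℂ)) (norm_nonneg T)
    (fun x => by
      rw [Complex.norm_real, norm_norm]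
      exact hT.norm_le x)
  obtain ⟨B, hB⟩ := hA.exists_eq_star_mul_self fun x => norm_nonneg _
  refine isTraceClass_of_mul_self_eq (A := A) ((hA.mul hA).ext ?_) hB deltaBasis ?_
  · convert hT.conj.mul hT using 2 with x
    rw [← Complex.ofReal_mul, ← Complex.normSq_eq_conj_mul_self, Complex.normSq_eq_norm_sq, sq]
  · refine hd.congr fun x => ?_
    rw [deltaBasis_apply, inner_deltaVec_left, hA, deltaVec_apply, if_pos rfl, mul_one,
      Complex.ofReal_re]

/-! ### The diagonal operator of an unbounded function -/

section Unbounded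

variable {ι : Type*}

local notation "ℓ²" => lp (fun _ : ι => ℂ) 2

lemma diagonalOp_apply (ω : ι → ℝ) (ξ : (diagonalOp ω).domain) (x : ι) :
    diagonalOp ω ξ x = (ω x : ℂ) * ξ.1 x := rfl

lemma deltaVec_mem_domain (ω : ι → ℝ) (x : ι) : deltaVec x ∈ (diagonalOp ω).domain := by
  change Memℓp (fun y => (ω y : ℂ) * deltaVec x y) 2
  have : (fun y => (ω y : ℂ) * deltaVec x y) = ⇑((ω x : ℂ) • deltaVec x : ℓ²) := by
    funext y
    rw [lp.coeFn_smul, Pi.smul_apply, smul_eq_mul, deltaVec_apply]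
    split_ifs with h
    · rw [h]
    · simp
  rw [this]
  exact lp.memℓp _

lemma diagonalOp_deltaVec (ω : ι → ℝ) (x : ι) :
    diagonalOp ω ⟨deltaVec x, deltaVec_mem_domain ω x⟩ = (ω x : ℂ) • deltaVec x := by
  ext y
  rw [diagonalOp_apply, lp.coeFn_smul, Pi.smul_apply, smul_eq_mul, deltaVec_apply]
  split_ifs with h
  · rw [h]
  · simp

lemma dense_domain_diagonalOp (ω : ι → ℝ) : Dense ((diagonalOp ω).domain : Set ℓ²) := by
  intro ξ
  refine mem_closure_of_tendsto (hasSum_smul_deltaVec ξ) (Eventually.of_forall fun F => ?_)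
  exact Submodule.sum_mem _ fun x _ => Submodule.smul_mem _ _ (deltaVec_mem_domain ω x)

lemma isSelfAdjoint_diagonalOp (ω : ι → ℝ) : IsSelfAdjoint (diagonalOp ω) := by
  have hd := dense_domain_diagonalOp ω
  have hle : diagonalOp ω ≤ (diagonalOp ω).adjoint := by
    refine LinearPMap.IsFormalAdjoint.le_adjoint hd fun ξ η => ?_
    rw [lp.inner_eq_tsum, lp.inner_eq_tsum]
    refine tsum_congr fun x => ?_
    rw [diagonalOp_apply, diagonalOp_apply, RCLike.inner_apply, RCLike.inner_apply, map_mul,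
      Complex.conj_ofReal]
    ring
  rw [LinearPMap.isSelfAdjoint_def]
  refine le_antisymm ?_ hle
  have key : ∀ (η : (diagonalOp ω).adjoint.domain) x,
      (diagonalOp ω).adjoint η x = (ω x : ℂ) * (η : ℓ²) x := by
    intro η x
    have h := LinearPMap.adjoint_isFormalAdjoint hd η ⟨deltaVec x, deltaVec_mem_domain ω x⟩
    rw [diagonalOp_deltaVec, inner_smul_right, ← inner_conj_symm, ← inner_conj_symm (η : ℓ²),
      inner_deltaVec_left, inner_deltaVec_left, ← Complex.conj_ofReal, ← map_mul] at h
    exact (starRingEnd ℂ).injective h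
  have hmem : (diagonalOp ω).adjoint.domain ≤ (diagonalOp ω).domain := by
    intro η hη
    change Memℓp (fun x => (ω x : ℂ) * η x) 2
    have : (fun x => (ω x : ℂ) * η x) = ⇑((diagonalOp ω).adjoint ⟨η, hη⟩) := by
      funext x
      rw [key]
    rw [this]
    exact lp.memℓp _
  refine ⟨hmem, fun ξ η hξη => ?_⟩
  ext x
  rw [key, diagonalOp_apply, hξη]

lemma one_add_sq_inv_mem (a : ℝ) : 0 < (1 + a ^ 2)⁻¹ ∧ (1 + a ^ 2)⁻¹ ≤ 1 :=
  ⟨by positivity, inv_le_one_of_one_le₀ (by nlinarith [sq_nonneg a])⟩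

lemma exists_isInvOneAddSq (ω : ι → ℝ) :
    ∃ R : ℓ² →L[ℂ] ℓ², IsDiag R (fun x => (((1 + ω x ^ 2)⁻¹ : ℝ) : ℂ)) ∧
      IsInvOneAddSq (diagonalOp ω) R := by
  obtain ⟨R, hR, -⟩ := exists_isDiag (d := fun x => (((1 + ω x ^ 2)⁻¹ : ℝ) : ℂ)) zero_le_one
    (fun x => by
      rw [Complex.norm_real, Real.norm_of_nonneg (one_add_sq_inv_mem (ω x)).1.le]
      exact (one_add_sq_inv_mem (ω x)).2)
  obtain ⟨B, hB, -⟩ := exists_isDiag (d := fun x => ((ω x * (1 + ω x ^ 2)⁻¹ : ℝ) : ℂ))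
    zero_le_one (fun x => by
      rw [Complex.norm_real, Real.norm_eq_abs, abs_mul,
        abs_of_pos (one_add_sq_inv_mem (ω x)).1, ← div_eq_mul_inv,
        div_le_one (by positivity)]
      nlinarith [sq_abs (ω x), sq_nonneg (|ω x| - 1)])
  obtain ⟨C, hC, -⟩ := exists_isDiag (d := fun x => ((ω x * (ω x * (1 + ω x ^ 2)⁻¹) : ℝ) : ℂ))
    zero_le_one (fun x => by
      rw [Complex.norm_real, ← mul_assoc, ← sq, ← div_eq_mul_inv, Real.norm_of_nonneg
        (by positivity), div_le_one (by positivity)]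
      linarith)
  refine ⟨R, hR, fun ξ => ?_⟩
  have h₁ : R ξ ∈ (diagonalOp ω).domain := by
    change Memℓp (fun x => (ω x : ℂ) * R ξ x) 2
    have : (fun x => (ω x : ℂ) * R ξ x) = ⇑(B ξ) := by
      funext x
      rw [hR, hB]
      push_cast
      ring
    rw [this]
    exact lp.memℓp _
  have e₁ : diagonalOp ω ⟨R ξ, h₁⟩ = B ξ := by
    ext x
    rw [diagonalOp_apply, hR, hB]
    push_cast
    ring
  have h₂ : diagonalOp ω ⟨R ξ, h₁⟩ ∈ (diagonalOp ω).domain := by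
    change Memℓp (fun x => (ω x : ℂ) * diagonalOp ω ⟨R ξ, h₁⟩ x) 2
    have : (fun x => (ω x : ℂ) * diagonalOp ω ⟨R ξ, h₁⟩ x) = ⇑(C ξ) := by
      funext x
      rw [e₁, hB, hC]
      push_cast
      ring
    rw [this]
    exact lp.memℓp _
  refine ⟨h₁, h₂, ?_⟩
  ext x
  rw [lp.coeFn_add, Pi.add_apply, diagonalOp_apply, hR]
  change _ + (ω x : ℂ) * (diagonalOp ω ⟨R ξ, h₁⟩ x) = _
  rw [e₁, hB]
  have hne : ((1 + ω x ^ 2 : ℝ) : ℂ) ≠ 0 := by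
    have : (1 + ω x ^ 2 : ℝ) ≠ 0 := by positivity
    exact_mod_cast this
  push_cast at hne ⊢
  field_simp

/-- `e^{-t(1 + D²)}` is diagonal with entries `e^{-t(1 + ω²)}`. -/
lemma isDiag_heatOp {ω : ι → ℝ} {R : ℓ² →L[ℂ] ℓ²}
    (hR : IsDiag R (fun x => (((1 + ω x ^ 2)⁻¹ : ℝ) : ℂ))) {t : ℝ} (ht : 0 < t) :
    IsDiag (heatOp R t) fun x => ((Real.exp (-t * (1 + ω x ^ 2)) : ℝ) : ℂ) := by
  obtain ⟨B, hB⟩ := hR.exists_eq_star_mul_self fun x => (one_add_sq_inv_mem (ω x)).1.le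
  refine isDiag_of_apply_deltaVec fun x => ?_
  rw [heatOp_apply_eigenvector hB ht (one_add_sq_inv_mem (ω x)).1.ne' (hR.apply_deltaVec x)
    (deltaVec_ne_zero x), div_inv_eq_mul]

end Unbounded

namespace SmaleSpace

section Irreducible

variable {X : Type*} [MetricSpace X] [CompactSpace X] {S : SmaleSpace X} {P Q : Set X}

/-! ### Existence of heteroclinic points -/

/-- Irreducibility gives topological transitivity in forward time: a periodic point near a
suitable point of the dense orbit turns a negative transition time into a positive one. -/
lemma Irreducible.exists_iterate_mem (hS : S.Irreducible) {U V : Set X} (hU : IsOpen U)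
    (hV : IsOpen V) (hU' : U.Nonempty) (hV' : V.Nonempty) :
    ∃ (n : ℕ), ∃ w ∈ U, S.φ^[n] w ∈ V := by
  obtain ⟨hper, x, hx⟩ := hS
  obtain ⟨_, ⟨i, rfl⟩, hi⟩ := hx.exists_mem_open hU hU'
  obtain ⟨_, ⟨j, rfl⟩, hj⟩ := hx.exists_mem_open hV hV'
  obtain ⟨y, ⟨m, hm, hym⟩, hyU, hyV⟩ := hper.exists_mem_open
    (hU.inter (hV.preimage (S.φ ^ (j - i)).continuous)) ⟨(S.φ ^ i) x, hi, by
      rw [mem_preimage, ← zpow_add_apply]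
      simpa using hj⟩
  refine ⟨(j - i + (m * (j - i).natAbs : ℕ)).toNat, y, hyU, ?_⟩
  have h0 : 0 ≤ j - i + (m * (j - i).natAbs : ℕ) := by
    have h₁ : (j - i).natAbs ≤ m * (j - i).natAbs := Nat.le_mul_of_pos_left _ hm
    omega
  have hfix : S.φ^[m * (j - i).natAbs] y = y := by
    rw [mul_comm]
    exact hym.const_mul _
  rw [← zpow_natCast_apply, Int.toNat_of_nonneg h0, zpow_add_apply, zpow_natCast_apply, hfix]
  exact hyV

/-- `[x, y]` lies in `X^s(x, r) ∩ X^u(y, r)` for nearby points `x` and `y`. -/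
lemma exists_bracket_mem (S : SmaleSpace X) {r : ℝ} (hr : 0 < r) (hr' : r ≤ S.eps) :
    ∃ η > 0, ∀ x y, dist x y < η →
      S.bracket x y ∈ S.localStable x r ∧ S.bracket x y ∈ S.localUnstable y r := by
  obtain ⟨η, hη, hηe, H⟩ := S.exists_dist_bracket_lt (half_pos hr)
  refine ⟨min η (r / 2), lt_min hη (half_pos hr), fun x y hxy => ?_⟩
  have h₁ := hxy.trans_le (min_le_left _ _)
  have h₂ := hxy.trans_le (min_le_right _ _)
  have h₃ := H x y h₁
  have h₄ : dist x (S.bracket x y) < r := by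
    have := dist_triangle_right x (S.bracket x y) y
    linarith
  have h₅ : dist y (S.bracket x y) < r := by
    rw [dist_comm]
    linarith
  refine ⟨⟨h₄, ?_⟩, h₅, ?_⟩
  · rw [S.bracket_left x y x (h₁.trans_le hηe) (by rw [dist_comm]; exact h₄.trans_le hr')
      (by simpa using S.eps_pos), S.bracket_self]
  · rw [S.bracket_right y x y (h₁.trans_le hηe) (h₅.trans_le hr') (by simpa using S.eps_pos),
      S.bracket_self]

/-- A heteroclinic point is `[p, φⁿ[w, q]]` for a point `w` near `q ∈ Q` that some `φⁿ` maps
close to `p ∈ P`. -/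
lemma IsPeriodicPair.heteroclinic_nonempty (h : S.IsPeriodicPair P Q) (hS : S.Irreducible)
    (hP : P.Nonempty) (hQ : Q.Nonempty) : (S.heteroclinic P Q).Nonempty := by
  obtain ⟨p, hp⟩ := hP
  obtain ⟨q, hq⟩ := hQ
  obtain ⟨η, hη, H⟩ := S.exists_bracket_mem S.eps_pos le_rfl
  obtain ⟨η', hη', H'⟩ := S.exists_bracket_mem (lt_min S.eps_pos (half_pos hη)) (min_le_left _ _)
  obtain ⟨n, w, hw, hnw⟩ := hS.exists_iterate_mem (Metric.isOpen_ball (x := q) (ε := η'))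
    (Metric.isOpen_ball (x := p) (ε := η / 2)) ⟨q, Metric.mem_ball_self hη'⟩
    ⟨p, Metric.mem_ball_self (half_pos hη)⟩
  obtain ⟨hs, hu⟩ := H' w q hw
  have hs' := iterate_mem_localStable' (min_le_left _ _) hs n
  have hd : dist p (S.φ^[n] (S.bracket w q)) < η := by
    have h₁ := hs'.1.trans_le (min_le_right _ _)
    have h₂ : dist (S.φ^[n] w) p < η / 2 := hnw
    rw [dist_comm] at h₂
    linarith [dist_triangle p (S.φ^[n] w) (S.φ^[n] (S.bracket w q))]
  obtain ⟨hs₁, hu₁⟩ := H _ _ hd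
  refine ⟨_, ⟨p, hp, stableEquiv_of_mem_localStable hs₁⟩, ?_⟩
  have hz : S.φ^[n] (S.bracket w q) ∈ S.unstableSet Q := by
    rw [← zpow_natCast_apply,
      zpow_mem_iff fun _ => map_mem_unstableSet_iff h.finite_right h.mapsTo_right]
    exact ⟨q, hq, unstableEquiv_of_mem_localUnstable (localUnstable_mono (min_le_left _ _) hu)⟩
  obtain ⟨q', hq', hqz⟩ := hz
  exact ⟨q', hq', hqz.trans (unstableEquiv_of_mem_localUnstable hu₁)⟩

lemma IsPeriodicPair.entryTime_zpow (h : S.IsPeriodicPair P Q) {ε : ℝ} (h0 : 0 < ε)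
    (hε : ε ≤ S.eps) {x : X} (hx : x ∈ S.heteroclinic P Q) (k : ℤ) :
    S.entryTime P ε ((S.φ ^ k) x) = S.entryTime P ε x - k :=
  SmaleSpace.entryTime_zpow ε x k fun n => h.zpow_mem_localStableSet_iff h0 hε hx n

/-- The forward orbit of a heteroclinic point converges to `P` and leaves each compact part of
`X^u(Q)`. -/
lemma IsPeriodicPair.exists_notMem_leafCover (h : S.IsPeriodicPair P Q)
    (hne : (S.heteroclinic P Q).Nonempty) (t : Finset X) :
    ∃ x ∈ S.heteroclinic P Q, x ∉ S.leafCover t := by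
  obtain ⟨z, hz⟩ := hne
  have he := S.eps_pos
  obtain ⟨L, hL⟩ := h.exists_le_entryTime (half_pos he) le_rfl t
  have hz' := (h.zpow_mem_heteroclinic_iff (S.entryTime P (S.eps / 2) z + L + 1) z).2 hz
  refine ⟨_, hz', fun ht => ?_⟩
  have := hL _ hz' ht
  rw [h.entryTime_zpow (half_pos he) (by linarith) hz] at this
  omega

end Irreducible

section Representation

variable {X : Type*} [MetricSpace X] [CompactSpace X] {S : SmaleSpace X} {P Q : Set X}

/-! ### The fundamental representation -/

open Classical in
variable (S P Q) in
/-- The kernel on `X^h(P, Q)` of the operator `π(f)`. -/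
noncomputable def groupoidKernel (f : S.StableGroupoid Q → ℂ) (x y : S.heteroclinic P Q) : ℂ :=
  if h : S.StableEquiv x.1 y.1 then f ⟨(x.1, y.1), h, x.2.2, y.2.2⟩ else 0

lemma represents_iff_hasKernel {f : S.StableGroupoid Q → ℂ}
    {T : S.HilbertSp P Q →L[ℂ] S.HilbertSp P Q} :
    S.Represents P Q f T ↔ HasKernel T (S.groupoidKernel P Q f) := by
  refine forall_congr' fun ξ => forall_congr' fun x => ?_
  have : ∑' y : {y : S.heteroclinic P Q // S.StableEquiv x.1 y.1},
      f ⟨(x.1, y.1.1), y.2, x.2.2, y.1.2.2⟩ * ξ y.1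
      = ∑' y, S.groupoidKernel P Q f x y * ξ y := by
    have hsupp : Function.support (fun y => S.groupoidKernel P Q f x y * ξ y) ⊆
        range (Subtype.val : {y : S.heteroclinic P Q // S.StableEquiv x.1 y.1} → _) := by
      intro y hy
      by_contra hy'
      refine hy ?_
      change S.groupoidKernel P Q f x y * ξ y = 0
      rw [groupoidKernel, dif_neg fun h => hy' ⟨⟨y, h⟩, rfl⟩, zero_mul]
    rw [← Subtype.val_injective.tsum_eq hsupp]
    refine tsum_congr fun y => ?_
    rw [groupoidKernel, dif_pos y.2]
  rw [this]

lemma exists_mem_of_groupoidKernel_ne_zero {f : S.StableGroupoid Q → ℂ}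
    {x y : S.heteroclinic P Q} (h : S.groupoidKernel P Q f x y ≠ 0) :
    ∃ g : S.StableGroupoid Q, g.1 = (x.1, y.1) ∧ f g ≠ 0 ∧ S.groupoidKernel P Q f x y = f g := by
  unfold groupoidKernel at h ⊢
  split_ifs at h ⊢ with h'
  · exact ⟨_, rfl, h, rfl⟩
  · exact absurd rfl h

/-- The support of `f ∈ C_c(G)` meets finitely many basic sets, each of which contributes at
most one point to each row and each column of the kernel. -/
lemma isBandKernel_groupoidKernel (f : C_c(S.StableGroupoid Q, ℂ)) :
    IsBandKernel (S.groupoidKernel P Q f) := by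
  classical
  obtain ⟨T, hT, hf⟩ := exists_finset_basicSet_cover f
  obtain ⟨C, hC⟩ := f.hasCompactSupport.exists_bound_of_continuous f.continuous
  let r : S.heteroclinic P Q → Finset (S.heteroclinic P Q) := fun x => T.image fun V =>
    if h : ∃ y : S.heteroclinic P Q, ∃ g ∈ V, g.1 = (x.1, y.1) then h.choose else x
  let c : S.heteroclinic P Q → Finset (S.heteroclinic P Q) := fun y => T.image fun V =>
    if h : ∃ x : S.heteroclinic P Q, ∃ g ∈ V, g.1 = (x.1, y.1) then h.choose else y
  refine ⟨|C|, T.card, r, c, abs_nonneg C, fun x y => ?_, fun x y hxy => ?_,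
    fun x => Finset.card_image_le, fun y => Finset.card_image_le⟩
  · by_cases h : S.groupoidKernel P Q f x y = 0
    · rw [h, norm_zero]
      exact abs_nonneg C
    · obtain ⟨g, -, -, hg⟩ := exists_mem_of_groupoidKernel_ne_zero h
      rw [hg]
      exact (hC g).trans (le_abs_self C)
  · obtain ⟨g, hg, hfg, -⟩ := exists_mem_of_groupoidKernel_ne_zero hxy
    obtain ⟨V, hV, hgV⟩ := hf g hfg
    obtain ⟨v, w, N, δ, hadm, rfl⟩ := hT V hV
    constructor
    · refine Finset.mem_image.2 ⟨_, hV, ?_⟩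
      have hex : ∃ y : S.heteroclinic P Q, ∃ g ∈ S.basicSet Q v w N δ, g.1 = (x.1, y.1) :=
        ⟨y, g, hgV, hg⟩
      rw [dif_pos hex]
      obtain ⟨g', hgV', hg'⟩ := hex.choose_spec
      have := eq_of_mem_basicSet_of_fst_eq hadm hgV' hgV (by rw [hg, hg'])
      rw [this, hg] at hg'
      exact Subtype.ext (congrArg Prod.snd hg').symm
    · refine Finset.mem_image.2 ⟨_, hV, ?_⟩
      have hex : ∃ x : S.heteroclinic P Q, ∃ g ∈ S.basicSet Q v w N δ, g.1 = (x.1, y.1) :=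
        ⟨x, g, hgV, hg⟩
      rw [dif_pos hex]
      obtain ⟨g', hgV', hg'⟩ := hex.choose_spec
      have := eq_of_mem_basicSet_of_snd_eq hgV' hgV (by rw [hg, hg'])
      rw [this, hg] at hg'
      exact Subtype.ext (congrArg Prod.fst hg').symm

lemma exists_leafCover_of_groupoidKernel (f : C_c(S.StableGroupoid Q, ℂ)) :
    ∃ t : Finset X, ∀ x y : S.heteroclinic P Q, S.groupoidKernel P Q f x y ≠ 0 →
      x.1 ∈ S.leafCover t ∧ y.1 ∈ S.leafCover t := by
  classical
  obtain ⟨T, hT, hf⟩ := exists_finset_basicSet_cover f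
  have hex : ∀ V : T, ∃ v w, ∀ g ∈ V.1,
      g.1.1 ∈ S.localUnstable v (S.eps / 2) ∧ g.1.2 ∈ S.localUnstable w (S.eps / 2) := by
    intro V
    obtain ⟨v, w, N, δ, hadm, e⟩ := hT V.1 V.2
    refine ⟨v, w, fun g hg => ?_⟩
    rw [e] at hg
    have hδ := hadm.2.2.2.2.2.1.le
    exact ⟨localUnstable_mono hδ hg.2.2.1, localUnstable_mono hδ hg.1⟩
  choose v w hvw using hex
  refine ⟨Finset.univ.image v ∪ Finset.univ.image w, fun x y hxy => ?_⟩
  obtain ⟨g, hg, hfg, -⟩ := exists_mem_of_groupoidKernel_ne_zero hxy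
  obtain ⟨V, hV, hgV⟩ := hf g hfg
  obtain ⟨h₁, h₂⟩ := hvw ⟨V, hV⟩ g hgV
  rw [hg] at h₁ h₂
  exact ⟨mem_leafCover.2 ⟨_, Finset.mem_union_left _ (Finset.mem_image_of_mem v
    (Finset.mem_univ _)), h₁⟩, mem_leafCover.2 ⟨_, Finset.mem_union_right _
    (Finset.mem_image_of_mem w (Finset.mem_univ _)), h₂⟩⟩

lemma IsPeriodicPair.exists_abs_omegaS_sub_le (h : S.IsPeriodicPair P Q) {ε : ℝ} (h0 : 0 < ε)
    (hε : ε ≤ S.eps / 2) {ω₀ : X → ℝ} (hω₀ : S.IsCutoff P ε ω₀)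
    (f : C_c(S.StableGroupoid Q, ℂ)) :
    ∃ L : ℝ, 0 ≤ L ∧ ∀ x y : S.heteroclinic P Q, S.groupoidKernel P Q f x y ≠ 0 →
      |S.omegaS ω₀ x - S.omegaS ω₀ y| ≤ L := by
  have he := S.eps_pos
  obtain ⟨T, hT, hf⟩ := exists_finset_basicSet_cover f
  have hex : ∀ V : T, ∃ K : ℕ, ∀ g ∈ V.1, g.1.1 ∈ S.heteroclinic P Q →
      g.1.2 ∈ S.heteroclinic P Q → |S.entryTime P ε g.1.1 - S.entryTime P ε g.1.2| ≤ K := by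
    intro V
    obtain ⟨v, w, N, δ, hadm, e⟩ := hT V.1 V.2
    rw [e]
    exact h.exists_abs_entryTime_sub_le h0 hε hadm
  choose K hK using hex
  refine ⟨(∑ V, K V : ℕ) + 1, by positivity, fun x y hxy => ?_⟩
  obtain ⟨g, hg, hfg, -⟩ := exists_mem_of_groupoidKernel_ne_zero hxy
  obtain ⟨V, hV, hgV⟩ := hf g hfg
  have h₁ := hK ⟨V, hV⟩ g hgV (by rw [hg]; exact x.2) (by rw [hg]; exact y.2)
  rw [hg] at h₁
  have h₂ : K ⟨V, hV⟩ ≤ ∑ V, K V :=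
    Finset.single_le_sum (fun _ _ => Nat.zero_le _) (Finset.mem_univ _)
  have h₃ : |(S.entryTime P ε x.1 : ℝ) - S.entryTime P ε y.1| ≤ (∑ V, K V : ℕ) := by
    have : |S.entryTime P ε x.1 - S.entryTime P ε y.1| ≤ ((∑ V, K V : ℕ) : ℤ) :=
      h₁.trans (by exact_mod_cast h₂)
    exact_mod_cast this
  have hx := h.omegaS_mem_Icc h0 (by linarith) hω₀ x.2
  have hy := h.omegaS_mem_Icc h0 (by linarith) hω₀ y.2
  rw [abs_le] at h₃ ⊢
  constructor <;> linarith [hx.1, hx.2, hy.1, hy.2, h₃.1, h₃.2]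

/-- The properties of the operators `π(f)` that are inherited by the `*`-algebra they generate:
bounded commutators with the diagonal operator of `ω`, and vanishing on the basis vectors outside
some compact part of `X^u(Q)`, for the operator and its adjoint. -/
def IsLocalOperator (ω : S.heteroclinic P Q → ℝ) (T : S.HilbertSp P Q →L[ℂ] S.HilbertSp P Q) :
    Prop :=
  (HasBoundedCommutator (diagonalOp ω) T ∧ HasBoundedCommutator (diagonalOp ω) (star T)) ∧
    ∃ t : Finset X, ∀ x : S.heteroclinic P Q, x.1 ∉ S.leafCover t →
      T (deltaVec x) = 0 ∧ star T (deltaVec x) = 0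

lemma IsPeriodicPair.isLocalOperator_of_mem_compactOps (h : S.IsPeriodicPair P Q) {ε : ℝ}
    (h0 : 0 < ε) (hε : ε ≤ S.eps / 2) {ω₀ : X → ℝ} (hω₀ : S.IsCutoff P ε ω₀)
    {T : S.HilbertSp P Q →L[ℂ] S.HilbertSp P Q} (hT : T ∈ S.compactOps P Q) :
    IsLocalOperator (fun x => S.omegaS ω₀ x.1) T := by
  obtain ⟨f, hf⟩ := hT
  have hk := represents_iff_hasKernel.1 hf
  have hb := isBandKernel_groupoidKernel (P := P) f
  obtain ⟨L, hL0, hL⟩ := h.exists_abs_omegaS_sub_le h0 hε hω₀ f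
  obtain ⟨t, ht⟩ := exists_leafCover_of_groupoidKernel (P := P) f
  refine ⟨⟨hk.hasBoundedCommutator hb hL0 hL,
    hk.conjTranspose.hasBoundedCommutator hb.conjTranspose hL0 fun x y hxy => ?_⟩,
    t, fun x hx => ⟨?_, ?_⟩⟩
  · rw [abs_sub_comm]
    exact hL y x fun h' => hxy (by simp only [h', map_zero])
  · ext y
    rw [hk.apply_deltaVec]
    by_contra h'
    exact hx (ht y x h').2
  · ext y
    rw [hk.conjTranspose.apply_deltaVec]
    by_contra h'
    exact hx (ht x y fun h'' => h' (by simp only [h'', map_zero]; rfl)).1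

lemma isLocalOperator_of_mem_adjoin {ω : S.heteroclinic P Q → ℝ}
    (hω : ∀ T ∈ S.compactOps P Q, IsLocalOperator ω T)
    {T : S.HilbertSp P Q →L[ℂ] S.HilbertSp P Q}
    (hT : T ∈ NonUnitalStarAlgebra.adjoin ℂ (S.compactOps P Q)) : IsLocalOperator ω T := by
  classical
  induction hT using NonUnitalStarAlgebra.adjoin_induction with
  | mem T hT => exact hω T hT
  | add A B _ _ hA hB =>
    obtain ⟨⟨hA₁, hA₂⟩, s, hs⟩ := hA
    obtain ⟨⟨hB₁, hB₂⟩, t, ht⟩ := hB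
    refine ⟨⟨hA₁.add hB₁, by rw [star_add]; exact hA₂.add hB₂⟩, s ∪ t, fun x hx => ?_⟩
    have h₁ := hs x fun h => hx (leafCover_mono Finset.subset_union_left h)
    have h₂ := ht x fun h => hx (leafCover_mono Finset.subset_union_right h)
    rw [star_add]
    constructor
    · change A _ + B _ = 0
      rw [h₁.1, h₂.1, add_zero]
    · change star A _ + star B _ = 0
      rw [h₁.2, h₂.2, add_zero]
  | zero =>
    refine ⟨⟨.zero, by rw [star_zero]; exact .zero⟩, ∅, fun x _ => ?_⟩
    rw [star_zero]
    exact ⟨rfl, rfl⟩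
  | mul A B _ _ hA hB =>
    obtain ⟨⟨hA₁, hA₂⟩, s, hs⟩ := hA
    obtain ⟨⟨hB₁, hB₂⟩, t, ht⟩ := hB
    refine ⟨⟨hA₁.mul hB₁, by rw [star_mul]; exact hB₂.mul hA₂⟩, s ∪ t, fun x hx => ?_⟩
    have h₁ := hs x fun h => hx (leafCover_mono Finset.subset_union_left h)
    have h₂ := ht x fun h => hx (leafCover_mono Finset.subset_union_right h)
    rw [star_mul]
    constructor
    · change A (B _) = 0
      rw [h₂.1, map_zero]
    · change star B (star A _) = 0
      rw [h₁.2, map_zero]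
  | smul c A _ hA =>
    obtain ⟨⟨hA₁, hA₂⟩, s, hs⟩ := hA
    refine ⟨⟨hA₁.smul c, by rw [star_smul]; exact hA₂.smul _⟩, s, fun x hx => ?_⟩
    rw [star_smul]
    constructor
    · change c • A _ = 0
      rw [(hs x hx).1, smul_zero]
    · change star c • star A (deltaVec x) = 0
      rw [(hs x hx).2, smul_zero]
  | star A _ hA =>
    obtain ⟨⟨hA₁, hA₂⟩, s, hs⟩ := hA
    refine ⟨⟨hA₂, by rwa [star_star]⟩, s, fun x hx => ?_⟩
    rw [star_star]
    exact (hs x hx).symm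

lemma exists_mem_compactOps_apply_deltaVec (x : S.heteroclinic P Q) :
    ∃ T ∈ S.compactOps P Q, T (deltaVec x) = deltaVec x := by
  obtain ⟨f, hf, hfx⟩ := exists_compactlySupported_unit x.2.2
  obtain ⟨T, hT⟩ := (isBandKernel_groupoidKernel (P := P) f).exists_hasKernel
  refine ⟨T, ⟨f, represents_iff_hasKernel.2 hT⟩, ?_⟩
  ext y
  rw [hT.apply_deltaVec, deltaVec_apply]
  split_ifs with h
  · rw [h, groupoidKernel, dif_pos (StableEquiv.refl _)]
    exact hfx _ rfl
  · by_contra h'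
    obtain ⟨g, hg, hfg, -⟩ := exists_mem_of_groupoidKernel_ne_zero h'
    have := hf g hfg
    rw [hg] at this
    exact h (Subtype.ext this)

end Representation

end SmaleSpace

namespace SmaleSpace

section SpectralTriple

variable {X : Type*} [MetricSpace X] [CompactSpace X] {S : SmaleSpace X} {P Q : Set X}

/-! ### The spectral triple -/

lemma coe_stableAlgebra : (S.stableAlgebra P Q : Set (S.HilbertSp P Q →L[ℂ] S.HilbertSp P Q)) =
    closure (NonUnitalStarAlgebra.adjoin ℂ (S.compactOps P Q)) := rfl

lemma separableSpace_l2 {ι : Type*} [Countable ι] :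
    TopologicalSpace.SeparableSpace (lp (fun _ : ι => ℂ) 2) := by
  have h := (((countable_range (deltaVec (ι := ι))).isSeparable).span (R := ℂ)).closure
  rw [← TopologicalSpace.isSeparable_univ_iff]
  refine h.mono fun ξ _ => ?_
  refine mem_closure_of_tendsto (hasSum_smul_deltaVec ξ) (Eventually.of_forall fun F => ?_)
  exact Submodule.sum_mem _ fun x _ => Submodule.smul_mem _ _ (Submodule.subset_span ⟨x, rfl⟩)

/-- A unit of the algebra fixes each `δ_x`, so it is the identity. The identity is not a limit
of operators that vanish on the basis vectors outside a compact part of `X^u(Q)`. -/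
lemma IsPeriodicPair.isNonunital_stableAlgebra (h : S.IsPeriodicPair P Q)
    (hne : (S.heteroclinic P Q).Nonempty) {ω : S.heteroclinic P Q → ℝ}
    (hω : ∀ T ∈ S.compactOps P Q, IsLocalOperator ω T) : IsNonunital (S.stableAlgebra P Q) := by
  rintro ⟨e, he, hunit⟩
  have he1 : e = 1 := ContinuousLinearMap.ext_deltaVec fun x => by
    obtain ⟨T, hT, hTx⟩ := exists_mem_compactOps_apply_deltaVec x
    have hTS : T ∈ S.stableAlgebra P Q :=
      subset_closure (NonUnitalStarAlgebra.subset_adjoin ℂ _ hT)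
    have h₁ := congrArg (fun A : S.HilbertSp P Q →L[ℂ] S.HilbertSp P Q => A (deltaVec x))
      (hunit T hTS).1
    change e (T (deltaVec x)) = T (deltaVec x) at h₁
    rw [hTx] at h₁
    exact h₁
  have hmem : e ∈ closure (NonUnitalStarAlgebra.adjoin ℂ (S.compactOps P Q) :
      Set (S.HilbertSp P Q →L[ℂ] S.HilbertSp P Q)) := he
  obtain ⟨b, hb, hdist⟩ := Metric.mem_closure_iff.1 hmem 1 one_pos
  obtain ⟨-, t, ht⟩ := isLocalOperator_of_mem_adjoin hω hb
  obtain ⟨x, hx, hxt⟩ := h.exists_notMem_leafCover hne t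
  have h₁ := (e - b).le_opNorm (deltaVec (⟨x, hx⟩ : S.heteroclinic P Q))
  rw [sub_apply, (ht ⟨x, hx⟩ hxt).1, he1, sub_zero, norm_deltaVec, mul_one] at h₁
  change ‖deltaVec (⟨x, hx⟩ : S.heteroclinic P Q)‖ ≤ _ at h₁
  rw [norm_deltaVec, ← he1, ← dist_eq_norm] at h₁
  exact absurd hdist (not_lt.2 h₁)

lemma IsPeriodicPair.tendsto_indicator_inv (h : S.IsPeriodicPair P Q) {ε : ℝ} (h0 : 0 < ε)
    (hε : ε ≤ S.eps / 2) {ω₀ : X → ℝ} (hω₀ : S.IsCutoff P ε ω₀) (t : Finset X) :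
    Tendsto (fun x : S.heteroclinic P Q =>
      (((S.leafCover t).indicator (fun x => (1 + S.omegaS ω₀ x ^ 2)⁻¹) x.1 : ℝ) : ℂ))
      cofinite (𝓝 0) := by
  have he := S.eps_pos
  rw [Metric.tendsto_nhds]
  intro r hr
  rw [Filter.eventually_cofinite]
  have hfin := (h.finite_entryTime_le h0 hε t ⌈r⁻¹ + 1⌉).preimage
    (Subtype.val_injective (p := (· ∈ S.heteroclinic P Q))).injOn
  refine hfin.subset fun x hx => ?_
  have hx' : ¬ dist (((S.leafCover t).indicator (fun x => (1 + S.omegaS ω₀ x ^ 2)⁻¹) x.1 : ℝ) : ℂ)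
      0 < r := hx
  rw [dist_zero_right, Complex.norm_real] at hx'
  by_cases hxt : x.1 ∈ S.leafCover t
  · refine ⟨x.2, hxt, ?_⟩
    rw [indicator_of_mem hxt, Real.norm_of_nonneg (one_add_sq_inv_mem _).1.le, not_lt,
      le_inv_comm₀ hr (by positivity)] at hx'
    have hI := (h.omegaS_mem_Icc h0 (by linarith) hω₀ x.2).1
    have hsq : S.omegaS ω₀ x.1 ≤ 1 + S.omegaS ω₀ x.1 ^ 2 := by
      nlinarith [sq_nonneg (S.omegaS ω₀ x.1 - 1)]
    have : (S.entryTime P ε x.1 : ℝ) ≤ ⌈r⁻¹ + 1⌉ := le_trans (by linarith) (Int.le_ceil _)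
    exact_mod_cast this
  · rw [indicator_of_notMem hxt] at hx'
    simp [hr] at hx'

/-- For an operator `a` that lives on a compact part of `X^u(Q)`, the operator `a (1 + D²)⁻¹`
factors through a diagonal operator whose entries tend to `0`. -/
lemma IsPeriodicPair.isCompactOperator_mul (h : S.IsPeriodicPair P Q) {ε : ℝ} (h0 : 0 < ε)
    (hε : ε ≤ S.eps / 2) {ω₀ : X → ℝ} (hω₀ : S.IsCutoff P ε ω₀)
    {R : S.HilbertSp P Q →L[ℂ] S.HilbertSp P Q}
    (hR : IsDiag R fun x => (((1 + S.omegaS ω₀ x.1 ^ 2)⁻¹ : ℝ) : ℂ))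
    {a : S.HilbertSp P Q →L[ℂ] S.HilbertSp P Q} (ha : a ∈ S.stableAlgebra P Q) :
    IsCompactOperator (a * R) := by
  have hloc : ∀ T ∈ S.compactOps P Q, IsLocalOperator (fun x => S.omegaS ω₀ x.1) T :=
    fun T hT => h.isLocalOperator_of_mem_compactOps h0 hε hω₀ hT
  have hcl : IsClosed {a : S.HilbertSp P Q →L[ℂ] S.HilbertSp P Q | IsCompactOperator (a * R)} :=
    (isClosed_setOfPred_isCompactOperator (σ₁₂ := RingHom.id ℂ) (M₁ := S.HilbertSp P Q)
      (M₂ := S.HilbertSp P Q)).preimage (continuous_mul_const R)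
  refine hcl.closure_subset_iff.2 (fun b hb => ?_) ha
  obtain ⟨-, t, ht⟩ := isLocalOperator_of_mem_adjoin hloc hb
  obtain ⟨B, hB, -⟩ := exists_isDiag (d := fun x : S.heteroclinic P Q =>
    (((S.leafCover t).indicator (fun x => (1 + S.omegaS ω₀ x ^ 2)⁻¹) x.1 : ℝ) : ℂ)) zero_le_one
    (fun x => by
      rw [Complex.norm_real, Real.norm_of_nonneg
        (indicator_nonneg (fun _ _ => (one_add_sq_inv_mem _).1.le) _)]
      exact indicator_apply_le' (fun _ => (one_add_sq_inv_mem _).2) fun _ => zero_le_one)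
  have e : b * R = b * B := ContinuousLinearMap.ext_deltaVec fun x => by
    change b (R _) = b (B _)
    rw [hR.apply_deltaVec, hB.apply_deltaVec]
    by_cases hx : x.1 ∈ S.leafCover t
    · rw [indicator_of_mem hx]
    · rw [map_smul, map_smul, (ht x hx).1, smul_zero, smul_zero]
  change IsCompactOperator (b * R)
  rw [e]
  exact (hB.isCompactOperator (h.tendsto_indicator_inv h0 hε hω₀ t)).clm_comp b

lemma IsPeriodicPair.not_bounded_dirac (h : S.IsPeriodicPair P Q)
    (hne : (S.heteroclinic P Q).Nonempty) {ε : ℝ} (h0 : 0 < ε)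
    (hε : ε ≤ S.eps / 2) {ω₀ : X → ℝ} (hω₀ : S.IsCutoff P ε ω₀) :
    ¬ ∃ C : ℝ, ∀ ξ : (S.dirac P Q ω₀).domain, ‖S.dirac P Q ω₀ ξ‖ ≤ C * ‖ξ‖ := by
  rintro ⟨C, hC⟩
  have he := S.eps_pos
  obtain ⟨z, hz⟩ := hne
  have hx := (h.zpow_mem_heteroclinic_iff (S.entryTime P ε z + ⌈C⌉ + 1) z).2 hz
  have hω := (h.omegaS_mem_Icc h0 (by linarith) hω₀ hx).2
  rw [h.entryTime_zpow h0 (by linarith) hz] at hω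
  set x : S.heteroclinic P Q := ⟨_, hx⟩
  have h₁ := hC ⟨deltaVec x, deltaVec_mem_domain _ x⟩
  have h₂ : S.dirac P Q ω₀ ⟨deltaVec x, deltaVec_mem_domain _ x⟩
      = (S.omegaS ω₀ x.1 : ℂ) • deltaVec x := diagonalOp_deltaVec _ x
  have h₃ : ‖(⟨deltaVec x, deltaVec_mem_domain _ x⟩ : (S.dirac P Q ω₀).domain)‖ = 1 :=
    norm_deltaVec x
  rw [h₂, h₃, norm_smul, norm_deltaVec, mul_one, mul_one, Complex.norm_real,
    Real.norm_eq_abs] at h₁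
  have h₄ := neg_le_abs (S.omegaS ω₀ x.1)
  have h₅ := Int.le_ceil C
  push_cast at hω
  linarith

lemma IsPeriodicPair.isSpectralTriple (h : S.IsPeriodicPair P Q)
    (hne : (S.heteroclinic P Q).Nonempty) {ε : ℝ} (h0 : 0 < ε)
    (hε : ε ≤ S.eps / 2) {ω₀ : X → ℝ} (hω₀ : S.IsCutoff P ε ω₀) :
    IsSpectralTriple (S.stableAlgebra P Q) (S.dirac P Q ω₀) where
  separable := by
    have := h.countable_heteroclinic.to_subtype
    exact separableSpace_l2
  selfAdjoint := isSelfAdjoint_diagonalOp _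
  unbounded := h.not_bounded_dirac hne h0 hε hω₀
  dense_commutator := by
    rw [coe_stableAlgebra]
    refine closure_mono fun b hb => ⟨subset_closure hb, ?_⟩
    exact (isLocalOperator_of_mem_adjoin
      (fun T hT => h.isLocalOperator_of_mem_compactOps h0 hε hω₀ hT) hb).1.1
  compact_resolvent := by
    obtain ⟨R, hR, hinv⟩ := exists_isInvOneAddSq fun x : S.heteroclinic P Q => S.omegaS ω₀ x.1
    exact ⟨R, hinv, fun a ha => h.isCompactOperator_mul h0 hε hω₀ hR ha⟩

lemma IsPeriodicPair.isThetaSummable (h : S.IsPeriodicPair P Q) {ε : ℝ} (h0 : 0 < ε)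
    (hε : ε ≤ S.eps / 2) {ω₀ : X → ℝ} (hω₀ : S.IsCutoff P ε ω₀) :
    S.IsThetaSummable P Q (S.dirac P Q ω₀) := by
  obtain ⟨R, hR, hinv⟩ := exists_isInvOneAddSq fun x : S.heteroclinic P Q => S.omegaS ω₀ x.1
  refine ⟨R, hinv, fun a => ?_⟩
  obtain ⟨t, ht⟩ := exists_leafCover_of_unitSpace a
  obtain ⟨C, hC⟩ := a.hasCompactSupport.exists_bound_of_continuous a.continuous
  have hC' : ∀ x, ‖a x‖ ≤ |C| := fun x => (hC x).trans (le_abs_self C)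
  obtain ⟨T, hT, -⟩ := exists_isDiag (d := fun x : S.heteroclinic P Q => a ⟨x.1, x.2.2⟩)
    (abs_nonneg C) (fun x => hC' _)
  refine ⟨T, fun ξ x => ?_, fun s hs => ?_⟩
  · rw [hT, tsum_eq_single ⟨x, StableEquiv.refl _⟩]
    · simp [unitFunction]
    · intro y hy
      have hxy : x.1 ≠ y.1.1 := fun e => hy (Subtype.ext (Subtype.ext e.symm))
      simp [unitFunction, hxy]
  · refine (hT.mul (isDiag_heatOp hR hs)).isTraceClass ?_
    refine Summable.of_nonneg_of_le (fun _ => norm_nonneg _) (fun x => ?_)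
      ((h.summable_exp h0 hε hω₀ t hs).mul_left |C|)
    rw [norm_mul, Complex.norm_real, Real.norm_of_nonneg (Real.exp_pos _).le]
    by_cases hx : a ⟨x.1, x.2.2⟩ = 0
    · rw [hx, norm_zero, zero_mul]
      exact mul_nonneg (abs_nonneg C) (indicator_nonneg (fun _ _ => (Real.exp_pos _).le) _)
    · rw [indicator_of_mem (ht ⟨x.1, x.2.2⟩ hx)]
      exact mul_le_mul_of_nonneg_right (hC' _) (Real.exp_pos _).le

end SpectralTriple

end SmaleSpace

theorem theorem4p8 {X : Type*} [MetricSpace X] [CompactSpace X] (S : SmaleSpace X)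
    (hS : S.Irreducible) (P Q : Set X)
    (hPfin : P.Finite) (hQfin : Q.Finite) (hPne : P.Nonempty) (hQne : Q.Nonempty)
    (hPper : P ⊆ Function.periodicPts S.φ) (hQper : Q ⊆ Function.periodicPts S.φ)
    (hPinv : Set.MapsTo S.φ P P) (hQinv : Set.MapsTo S.φ Q Q) (hPQ : Disjoint P Q)
    (ε : ℝ) (hε : 0 < ε) (hε' : ε ≤ S.lam⁻¹ * S.eps / 2)
    (ω₀ : X → ℝ) (hω₀ : S.IsCutoff P ε ω₀) :
    (∀ f : C_c(S.StableGroupoid Q, ℂ),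
      ∃ a : S.HilbertSp P Q →L[ℂ] S.HilbertSp P Q,
        S.Represents P Q f a ∧ HasBoundedCommutator (S.dirac P Q ω₀) a) ∧
    IsSpectralTriple (S.stableAlgebra P Q) (S.dirac P Q ω₀) ∧
    IsNonunital (S.stableAlgebra P Q) ∧
    S.IsThetaSummable P Q (S.dirac P Q ω₀) := by
  have h : S.IsPeriodicPair P Q := ⟨hPfin, hQfin, hPper, hQper, hPinv, hQinv, hPQ⟩
  have hne := h.heteroclinic_nonempty hS hPne hQne
  have hε₂ : ε ≤ S.eps / 2 := by
    have := mul_le_of_le_one_left S.eps_pos.le S.inv_lam_lt_one.le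
    linarith
  have hloc : ∀ T ∈ S.compactOps P Q, SmaleSpace.IsLocalOperator (fun x => S.omegaS ω₀ x.1) T :=
    fun T hT => h.isLocalOperator_of_mem_compactOps hε hε₂ hω₀ hT
  refine ⟨fun f => ?_, h.isSpectralTriple hne hε hε₂ hω₀, h.isNonunital_stableAlgebra hne hloc,
    h.isThetaSummable hε hε₂ hω₀⟩
  obtain ⟨T, hT⟩ := (SmaleSpace.isBandKernel_groupoidKernel (P := P) f).exists_hasKernel
  have hrep := SmaleSpace.represents_iff_hasKernel.2 hT
  exact ⟨T, hrep, (hloc T ⟨f, hrep⟩).1.1⟩
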